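/- Let $\mathbb K$ be a field, let $d\ge 3$ be an integer, let $\mathcal A$ be a $\mathbb K$-algebra isomorphic to $\mathrm{Mat}_{d+1}(\mathbb K)$, with identity $I$, and let $\Phi=(A;\{E_i\}_{i=0}^d;A^*;\{E^*_i\}_{i=0}^d)$ be a Leonard system in $\mathcal A$. That is: each of $A,A^*\in\mathcal A$ has $d+1$ mutually distinct eigenvalues in $\mathbb K$; $E_0,\dots,E_d$ is an ordering of the primitive idempotents of $A$, i.e. $E_i=\prod_{j\ne i}(A-\theta_jI)/(\theta_i-\theta_j)$ for some ordering $\theta_0,\dots,\theta_d$ of the eigenvalues of $A$, and $E^*_0,\dots,E^*_d$ is likewise an ordering of the primitive idempotents of $A^*$; and for $0\le i,j\le d$ each of $E_iA^*E_j$ and $E^*_iAE^*_j$ is zero if $|i-j|>1$ and nonzero if $|i-j|=1$. ($A^*$ is just a second element of $\mathcal A$, not an adjoint.) Let $\mathcal X$ be the subspace of all $X\in\mathcal A$ such that $E_iXE_j=0$ and $E^*_iXE^*_j=0$ whenever $|i-j|>1$. There is a unique sequence of scalars $\beta,\gamma,\gamma^*,\varrho,\varrho^*,\omega,\eta,\eta^*$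 in $\mathbb K$ with $$A^2A^*-\beta AA^*A+A^*A^2-\gamma(AA^*+A^*A)-\varrho A^*=\gamma^*A^2+\omega A+\eta I,$$ $$A^{*2}A-\beta A^*AA^*+AA^{*2}-\gamma^*(A^*A+AA^*)-\varrho^*A=\gamma A^{*2}+\omega A^*+\eta^*I.$$ For these scalars define linear maps on $\mathcal X$, with values in $\mathcal A$, by $$\Upsilon(X)=A^2X-\beta AXA+XA^2-\gamma(AX+XA)-\varrho X,$$ $$\Upsilon^*(X)=A^{*2}X-\beta A^*XA^*+XA^{*2}-\gamma^*(A^*X+XA^*)-\varrho^*X.$$ (i) Assume $\Phi$ is bipartite, i.e. $E^*_iAE^*_i=0$ for $0\le i\le d$. Then $$\mathrm{Ker}\,\Upsilon^*=\mathrm{Span}\{A,AA^*,A^*A\},\qquad \mathrm{Im}\,\Upsilon^*=\mathrm{Span}\{B^*,A^*B^*\},$$ where $B^*=(2-\beta)A^{*2}-2\gamma^*A^*-\varrho^*I$. In particular both inclusions $\mathrm{Span}\{AA^*-A^*A\}\subseteq\mathrm{Ker}\,\Upsilon^*$ and $\mathrm{Im}\,\Upsilon^*\subseteq\mathrm{Span}\{I,A^*,A^{*2},A^{*3}\}$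 are strict. (ii) Assume $\Phi$ is dual bipartite, i.e. $E_iA^*E_i=0$ for $0\le i\le d$. Then $$\mathrm{Ker}\,\Upsilon=\mathrm{Span}\{A^*,A^*A,AA^*\},\qquad \mathrm{Im}\,\Upsilon=\mathrm{Span}\{B,AB\},$$ where $B=(2-\beta)A^2-2\gamma A-\varrho I$. In particular both inclusions $\mathrm{Span}\{AA^*-A^*A\}\subseteq\mathrm{Ker}\,\Upsilon$ and $\mathrm{Im}\,\Upsilon\subseteq\mathrm{Span}\{I,A,A^2,A^3\}$ are strict. -/

import Mathlib

namespace Leonard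

section Defs

variable {K : Type*} [Field K] {𝒜 : Type*} [Ring 𝒜] [Algebra K 𝒜] {d : ℕ}

/-- `θ 0, …, θ d` are mutually distinct eigenvalues of `a` (`spectrum K a` is the set of
`t : K` such that `t • 1 - a` is not invertible; when `𝒜` is isomorphic to the algebra of
`d + 1` by `d + 1` matrices this is the set of eigenvalues of `a`, and there are at most
`d + 1` of them, so `θ` is an ordering of all the eigenvalues). -/
def IsEigenvalueOrdering (a : 𝒜) (θ : Fin (d + 1) → K) : Prop :=
  Function.Injective θ ∧ ∀ i, θ i ∈ spectrum K a

/-- The element `∏_{j ≠ i} (a - θ j • 1) / (θ i - θ j)`, obtained by evaluating the `i`-th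
Lagrange basis polynomial of the nodes `θ` at `a`. -/
noncomputable def primitiveIdempotent (a : 𝒜) (θ : Fin (d + 1) → K) (i : Fin (d + 1)) : 𝒜 :=
  Polynomial.aeval a (Lagrange.basis Finset.univ θ i)

variable (K) in
/-- `a` is multiplicity-free: it has `d + 1` mutually distinct eigenvalues in `K`. -/
def IsMultiplicityFree (d : ℕ) (a : 𝒜) : Prop :=
  ∃ θ : Fin (d + 1) → K, IsEigenvalueOrdering a θ

variable (K) in
/-- `E 0, …, E d` is an ordering of the primitive idempotents of `a`. -/
def IsIdempotentOrdering (a : 𝒜) (E : Fin (d + 1) → 𝒜) : Prop :=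
  ∃ θ : Fin (d + 1) → K, IsEigenvalueOrdering a θ ∧ ∀ i, E i = primitiveIdempotent a θ i

/-- The distance `|i - j|` between two indices. -/
def idxDist (i j : Fin (d + 1)) : ℤ := |(i : ℤ) - (j : ℤ)|

variable (K) in
/-- `(A; {E_i}; As; {Es_i})` is a Leonard system in `𝒜`; here `As`, `Es` stand for the
starred `A`, `E`. -/
structure IsLeonardSystem (A : 𝒜) (E : Fin (d + 1) → 𝒜) (As : 𝒜) (Es : Fin (d + 1) → 𝒜) :
    Prop where
  multFree : IsMultiplicityFree K d A
  multFree_star : IsMultiplicityFree K d As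
  idem : IsIdempotentOrdering K A E
  idem_star : IsIdempotentOrdering K As Es
  trid_zero : ∀ i j, 1 < idxDist i j → E i * As * E j = 0
  trid_ne_zero : ∀ i j, idxDist i j = 1 → E i * As * E j ≠ 0
  trid_star_zero : ∀ i j, 1 < idxDist i j → Es i * A * Es j = 0
  trid_star_ne_zero : ∀ i j, idxDist i j = 1 → Es i * A * Es j ≠ 0

/-- A Leonard system is bipartite when `Es i * A * Es i = 0` for all `i`. -/
def IsBipartite (A : 𝒜) (Es : Fin (d + 1) → 𝒜) : Prop := ∀ i, Es i * A * Es i = 0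

/-- A Leonard system is dual bipartite when `E i * As * E i = 0` for all `i`. -/
def IsDualBipartite (As : 𝒜) (E : Fin (d + 1) → 𝒜) : Prop := ∀ i, E i * As * E i = 0

variable (K) in
/-- The space of all `X` that are tridiagonal with respect to both `E` and `Es`. -/
def tridSpace (E Es : Fin (d + 1) → 𝒜) : Submodule K 𝒜 where
  carrier := {X | (∀ i j, 1 < idxDist i j → E i * X * E j = 0) ∧
    (∀ i j, 1 < idxDist i j → Es i * X * Es j = 0)}
  add_mem' := by
    rintro X Y ⟨h1, h2⟩ ⟨h3, h4⟩
    refine ⟨fun i j h => ?_, fun i j h => ?_⟩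
    · rw [mul_add, add_mul, h1 i j h, h3 i j h, add_zero]
    · rw [mul_add, add_mul, h2 i j h, h4 i j h, add_zero]
  zero_mem' := by simp
  smul_mem' := by
    rintro c X ⟨h1, h2⟩
    refine ⟨fun i j h => ?_, fun i j h => ?_⟩
    · rw [mul_smul_comm, smul_mul_assoc, h1 i j h, smul_zero]
    · rw [mul_smul_comm, smul_mul_assoc, h2 i j h, smul_zero]

/-- A sequence of eight scalars `β, γ, γ*, ϱ, ϱ*, ω, η, η*`. -/
@[ext] structure AWScalars (K : Type*) where
  β : K
  γ : K
  γs : K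
  ϱ : K
  ϱs : K
  ω : K
  η : K
  ηs : K

/-- The two Askey-Wilson relations for `A`, `As` with the scalars `s`. -/
def AskeyWilson (A As : 𝒜) (s : AWScalars K) : Prop :=
  A ^ 2 * As - s.β • (A * As * A) + As * A ^ 2 - s.γ • (A * As + As * A) - s.ϱ • As
      = s.γs • A ^ 2 + s.ω • A + s.η • (1 : 𝒜) ∧
  As ^ 2 * A - s.β • (As * A * As) + A * As ^ 2 - s.γs • (As * A + A * As) - s.ϱs • A
      = s.γ • As ^ 2 + s.ω • As + s.ηs • (1 : 𝒜)

/-- The linear map `X ↦ a²X - β aXa + Xa² - γ(aX + Xa) - ϱX` on a subspace `𝒳` of `𝒜`. With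
`a = A`, `β, γ, ϱ` it is `Υ`; with `a = As`, `β, γ*, ϱ*` it is `Υ*`. Its values are regarded
as elements of `𝒜`, so that its image is a subspace of `𝒜`. -/
def upsilon (𝒳 : Submodule K 𝒜) (a : 𝒜) (β γ ϱ : K) : 𝒳 →ₗ[K] 𝒜 where
  toFun X := a ^ 2 * (X : 𝒜) - β • (a * X * a) + X * a ^ 2 - γ • (a * X + X * a) - ϱ • (X : 𝒜)
  map_add' X Y := by
    simp only [Submodule.coe_add, mul_add, add_mul, smul_add]
    abel
  map_smul' c X := by
    simp only [Submodule.coe_smul, mul_smul_comm, smul_mul_assoc, RingHom.id_apply, smul_add,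
      smul_sub, smul_comm c]

/-- The kernel of a linear map defined on a subspace `𝒳` of `𝒜`, as a subspace of `𝒜`. -/
def kerIn {𝒳 : Submodule K 𝒜} (f : 𝒳 →ₗ[K] 𝒜) : Submodule K 𝒜 :=
  (LinearMap.ker f).map 𝒳.subtype

/-- The element `(2 - β)a² - 2γ a - ϱ 1`. -/
def elemB (a : 𝒜) (β γ ϱ : K) : 𝒜 :=
  (2 - β) • a ^ 2 - (2 * γ) • a - ϱ • (1 : 𝒜)

end Defs

end Leonard

namespace Leonard

/-! ### Matrix models: an eigenbasis for `A` and an eigenbasis for `As`. -/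

section Diagonalization

variable {K : Type*} [Field K] {𝒜 : Type*} [Ring 𝒜] [Algebra K 𝒜] {d : ℕ}

/-! Pass to two matrix models: `A` is diagonal and `As` irreducible tridiagonal in one, and the
reverse in the other. An element that is diagonal in the first model is a polynomial in `A`, and
column `0` of its second matrix bounds the degree and gives the leading coefficient.

Askey-Wilson relations. Apply this to an element `Z` whose commutator with `As` is `A²AsA - AAsA²`:
the entries of the resulting identity give a quadratic relation `awPoly` between consecutive
eigenvalues of `A`. Hence `Υ(As)` is diagonal in the first model and is a polynomial of degree at
most 2 in `A`. Exchanging `A` and `As` gives the other relation. The two values of `β` agree by a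
relation between the first four eigenvalues, and the two values of `ω` agree by a commutator
identity.

Bipartite case. The diagonal of the second relation forces `γ = ω = η* = 0`, so `Υ*(A) = 0`. Since
`Υ*` commutes with multiplication by `As` on either side, it also kills `A * As` and `As * A`, while
`1` and `As` go to `B*` and `As * B*`. Everything then follows from two facts. First, `1, A, As, A *
As, As * A` span the bitridiagonal space: a combination of them matches the first two columns of any
`X` in the `As`-model, and `eq_zero_of_commute_upsElem` kills the remainder because `Υ` of it
commutes with `A`; this needs `β ≠ 0, -1`. Second, `B*` and `As * B*` are independent, since `B*`
has at most two zero eigenvalues among the first four. The dual bipartite case is the same statement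
with the generators exchanged. -/

lemma exists_algEquiv_diagonal
    (h𝒜 : Nonempty (𝒜 ≃ₐ[K] Matrix (Fin (d + 1)) (Fin (d + 1)) K)) {a : 𝒜}
    {θ : Fin (d + 1) → K} (h : IsEigenvalueOrdering a θ) :
    ∃ φ : 𝒜 ≃ₐ[K] Matrix (Fin (d + 1)) (Fin (d + 1)) K, φ a = Matrix.diagonal θ := by
  obtain ⟨e⟩ := h𝒜
  let f : Module.End K (Fin (d + 1) → K) := Matrix.toLinAlgEquiv' (e a)
  have hev : ∀ i, f.HasEigenvalue (θ i) := by
    intro i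
    rw [Module.End.hasEigenvalue_iff_mem_spectrum]
    have := h.2 i
    rwa [← AlgEquiv.spectrum_eq e, ← AlgEquiv.spectrum_eq Matrix.toLinAlgEquiv'] at this
  choose v hv using fun i => (hev i).exists_hasEigenvector
  have hli : LinearIndependent K v :=
    Module.End.eigenvectors_linearIndependent' f θ h.1 v hv
  let b := basisOfLinearIndependentOfCardEqFinrank hli (by simp)
  refine ⟨(e.trans Matrix.toLinAlgEquiv').trans (LinearMap.toMatrixAlgEquiv b), ?_⟩
  ext i j
  have hb : f (b j) = θ j • b j := by
    simpa [b] using (hv j).apply_eq_smul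
  change LinearMap.toMatrixAlgEquiv b f i j = _
  rw [LinearMap.toMatrixAlgEquiv_apply, hb]
  by_cases hij : i = j
  · subst hij; simp
  · simp [Matrix.diagonal_apply_ne _ hij, Ne.symm hij]

lemma aeval_diagonal (θ : Fin (d + 1) → K) (p : Polynomial K) :
    Polynomial.aeval (Matrix.diagonal θ) p = Matrix.diagonal fun i => p.eval (θ i) := by
  induction p using Polynomial.induction_on' with
  | add p q hp hq => simp [hp, hq, Matrix.diagonal_add]
  | monomial n c =>
    ext i j
    by_cases hij : i = j
    · subst hij; simp [Polynomial.aeval_monomial, Matrix.diagonal_pow, Algebra.algebraMap_eq_smul_one]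
    · simp [Polynomial.aeval_monomial, Matrix.diagonal_pow, Algebra.algebraMap_eq_smul_one, hij]

lemma map_primitiveIdempotent {a : 𝒜} {θ : Fin (d + 1) → K} (hθ : Function.Injective θ)
    (φ : 𝒜 ≃ₐ[K] Matrix (Fin (d + 1)) (Fin (d + 1)) K) (hφ : φ a = Matrix.diagonal θ)
    (i : Fin (d + 1)) : φ (primitiveIdempotent a θ i) = Matrix.single i i 1 := by
  have : φ (primitiveIdempotent a θ i) =
      Polynomial.aeval (φ a) (Lagrange.basis Finset.univ θ i) :=
    (Polynomial.aeval_algHom_apply φ.toAlgHom a _).symm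
  rw [this, hφ, aeval_diagonal]
  ext j k
  by_cases hjk : j = k
  · subst hjk
    by_cases hij : i = j
    · subst hij
      simp [Lagrange.eval_basis_self hθ.injOn (Finset.mem_univ _)]
    · rw [Matrix.diagonal_apply_eq, Lagrange.eval_basis_of_ne hij (Finset.mem_univ _)]
      simp [hij]
  · rw [Matrix.diagonal_apply_ne _ hjk, Matrix.single_apply]
    rw [if_neg]
    rintro ⟨rfl, rfl⟩
    exact hjk rfl

/-- `M` is tridiagonal. -/
def IsTri (M : Matrix (Fin (d + 1)) (Fin (d + 1)) K) : Prop :=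
  ∀ i j, 1 < idxDist i j → M i j = 0

/-- The entries of `M` next to the diagonal are nonzero. -/
def IsIrred (M : Matrix (Fin (d + 1)) (Fin (d + 1)) K) : Prop :=
  ∀ i j, idxDist i j = 1 → M i j ≠ 0

lemma idempotent_sandwich_eq_zero_iff {E : Fin (d + 1) → 𝒜}
    (φ : 𝒜 ≃ₐ[K] Matrix (Fin (d + 1)) (Fin (d + 1)) K)
    (hE : ∀ i, φ (E i) = Matrix.single i i 1) (X : 𝒜) (i j : Fin (d + 1)) :
    E i * X * E j = 0 ↔ φ X i j = 0 := by
  rw [← map_eq_zero_iff φ φ.injective, map_mul, map_mul, hE, hE,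
    Matrix.single_mul_mul_single, one_mul, mul_one]
  refine ⟨fun h => ?_, fun h => by rw [h, Matrix.single_zero]⟩
  have := congrFun (congrFun h i) j
  rwa [Matrix.single_apply_same] at this

variable (K) in
/-- Two matrix models of a Leonard system: `φ` diagonalizes `A`, and `ψ` diagonalizes `As`. -/
structure Model (A : 𝒜) (E : Fin (d + 1) → 𝒜) (As : 𝒜) (Es : Fin (d + 1) → 𝒜) where
  φ : 𝒜 ≃ₐ[K] Matrix (Fin (d + 1)) (Fin (d + 1)) K
  ψ : 𝒜 ≃ₐ[K] Matrix (Fin (d + 1)) (Fin (d + 1)) K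
  θ : Fin (d + 1) → K
  θs : Fin (d + 1) → K
  θ_inj : Function.Injective θ
  θs_inj : Function.Injective θs
  φ_A : φ A = Matrix.diagonal θ
  ψ_As : ψ As = Matrix.diagonal θs
  φ_E : ∀ i, φ (E i) = Matrix.single i i 1
  ψ_Es : ∀ i, ψ (Es i) = Matrix.single i i 1
  tri : IsTri (φ As)
  irred : IsIrred (φ As)
  tri_star : IsTri (ψ A)
  irred_star : IsIrred (ψ A)

variable {A As : 𝒜} {E Es : Fin (d + 1) → 𝒜}

lemma IsLeonardSystem.nonempty_model
    (h𝒜 : Nonempty (𝒜 ≃ₐ[K] Matrix (Fin (d + 1)) (Fin (d + 1)) K))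
    (h : IsLeonardSystem K A E As Es) : Nonempty (Model K A E As Es) := by
  obtain ⟨θ, hθ, hE⟩ := h.idem
  obtain ⟨θs, hθs, hEs⟩ := h.idem_star
  obtain ⟨φ, hφ⟩ := exists_algEquiv_diagonal h𝒜 hθ
  obtain ⟨ψ, hψ⟩ := exists_algEquiv_diagonal h𝒜 hθs
  have h1 : ∀ i, φ (E i) = Matrix.single i i 1 := fun i => by
    rw [hE]; exact map_primitiveIdempotent hθ.1 φ hφ i
  have h2 : ∀ i, ψ (Es i) = Matrix.single i i 1 := fun i => by
    rw [hEs]; exact map_primitiveIdempotent hθs.1 ψ hψ i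
  exact ⟨{
    φ := φ
    ψ := ψ
    θ := θ
    θs := θs
    θ_inj := hθ.1
    θs_inj := hθs.1
    φ_A := hφ
    ψ_As := hψ
    φ_E := h1
    ψ_Es := h2
    tri := fun i j hij => (idempotent_sandwich_eq_zero_iff φ h1 _ i j).1 (h.trid_zero i j hij)
    irred := fun i j hij h0 =>
      h.trid_ne_zero i j hij ((idempotent_sandwich_eq_zero_iff φ h1 _ i j).2 h0)
    tri_star := fun i j hij =>
      (idempotent_sandwich_eq_zero_iff ψ h2 _ i j).1 (h.trid_star_zero i j hij)
    irred_star := fun i j hij h0 =>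
      h.trid_star_ne_zero i j hij ((idempotent_sandwich_eq_zero_iff ψ h2 _ i j).2 h0) }⟩

/-- Interchange the roles of `A` and `As`. -/
def Model.swap (m : Model K A E As Es) : Model K As Es A E where
  φ := m.ψ
  ψ := m.φ
  θ := m.θs
  θs := m.θ
  θ_inj := m.θs_inj
  θs_inj := m.θ_inj
  φ_A := m.ψ_As
  ψ_As := m.φ_A
  φ_E := m.ψ_Es
  ψ_Es := m.φ_E
  tri := m.tri_star
  irred := m.irred_star
  tri_star := m.tri
  irred_star := m.irred

lemma Model.mem_tridSpace (m : Model K A E As Es) (X : 𝒜) :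
    X ∈ tridSpace K E Es ↔ IsTri (m.φ X) ∧ IsTri (m.ψ X) := by
  change (_ ∧ _) ↔ _
  simp only [idempotent_sandwich_eq_zero_iff m.φ m.φ_E,
    idempotent_sandwich_eq_zero_iff m.ψ m.ψ_Es, IsTri]

end Diagonalization

/-! ### Extreme entries of products of band matrices. -/

section Band

variable {K : Type*} [Field K] {d : ℕ}

/-- `M i j` vanishes when `i > j + k`. -/
def HasBand (M : Matrix (Fin (d + 1)) (Fin (d + 1)) K) (k : ℕ) : Prop :=
  ∀ i j : Fin (d + 1), (j : ℕ) + k < i → M i j = 0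

variable {M N : Matrix (Fin (d + 1)) (Fin (d + 1)) K} {k l : ℕ}

lemma HasBand.mul (hM : HasBand M k) (hN : HasBand N l) : HasBand (M * N) (k + l) := by
  intro i j hij
  rw [Matrix.mul_apply]
  refine Finset.sum_eq_zero fun r _ => ?_
  by_cases hr : (j : ℕ) + l < r
  · rw [hN r j hr, mul_zero]
  · rw [hM i r (by omega), zero_mul]

lemma HasBand.mul_apply (hM : HasBand M k) (hN : HasBand N l) {i j r : Fin (d + 1)}
    (hr : (r : ℕ) = j + l) (hi : (i : ℕ) = r + k) : (M * N) i j = M i r * N r j := by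
  rw [Matrix.mul_apply]
  refine Finset.sum_eq_single r (fun t _ ht => ?_) (by simp)
  have : (t : ℕ) ≠ r := fun h => ht (Fin.ext h)
  by_cases hr : (j : ℕ) + l < t
  · rw [hN t j hr, mul_zero]
  · rw [hM i t (by omega), zero_mul]

lemma hasBand_diagonal (θ : Fin (d + 1) → K) : HasBand (Matrix.diagonal θ) 0 :=
  fun i j hij => Matrix.diagonal_apply_ne _ (fun h => by subst h; omega)

lemma IsTri.hasBand (hM : IsTri M) : HasBand M 1 := by
  intro i j hij
  refine hM i j ?_
  rw [idxDist, lt_abs]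
  left; omega

lemma IsTri.hasBand_pow (hM : IsTri M) (n : ℕ) : HasBand (M ^ n) n := by
  induction n with
  | zero => rw [pow_zero, ← Matrix.diagonal_one]; exact hasBand_diagonal _
  | succ n ih => rw [pow_succ]; exact ih.mul hM.hasBand

/-- Only one path of length `n` climbs from `j` to `j + n`, so the entry is a product of `n`
subdiagonal entries. -/
lemma pow_apply_ne_zero (hM : IsTri M) (hM' : IsIrred M) (n : ℕ) {i j : Fin (d + 1)}
    (h : (i : ℕ) = j + n) : (M ^ n) i j ≠ 0 := by
  induction n generalizing j with
  | zero =>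
    obtain rfl : i = j := Fin.ext (by omega)
    simp
  | succ n ih =>
    have hj : (j : ℕ) + 1 < d + 1 := by omega
    rw [pow_succ, (hM.hasBand_pow n).mul_apply hM.hasBand (r := ⟨j + 1, hj⟩) rfl
      (by simp only; omega)]
    refine mul_ne_zero (ih (by simp only; omega)) (hM' _ _ ?_)
    simp [idxDist]

end Band

/-! ### The quadratic recurrence satisfied by consecutive eigenvalues. -/

section Recurrence

variable {K : Type*} [Field K] {𝒜 : Type*} [Ring 𝒜] [Algebra K 𝒜] {d : ℕ}
  {A As : 𝒜} {E Es : Fin (d + 1) → 𝒜}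

lemma idxDist_eq_one_iff {i j : Fin (d + 1)} :
    idxDist i j = 1 ↔ (i : ℕ) = j + 1 ∨ (j : ℕ) = i + 1 := by
  rw [idxDist, abs_eq zero_le_one]; omega

lemma one_lt_idxDist_iff {i j : Fin (d + 1)} :
    1 < idxDist i j ↔ (j : ℕ) + 1 < i ∨ (i : ℕ) + 1 < j := by
  rw [idxDist, lt_abs]; omega

lemma idxDist_trichotomy (i j : Fin (d + 1)) :
    i = j ∨ idxDist i j = 1 ∨ 1 < idxDist i j := by
  rw [idxDist_eq_one_iff, one_lt_idxDist_iff, Fin.ext_iff]; omega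

/-- The polynomial `x² - βxy + y² - γ(x + y) - ϱ`. -/
def awPoly (β γ ϱ x y : K) : K := x ^ 2 - β * x * y + y ^ 2 - γ * (x + y) - ϱ

/-- The element `a²X - βaXa + Xa² - γ(aX + Xa) - ϱX`. -/
def upsElem (β γ ϱ : K) (a X : 𝒜) : 𝒜 :=
  a ^ 2 * X - β • (a * X * a) + X * a ^ 2 - γ • (a * X + X * a) - ϱ • X

lemma upsElem_diagonal_apply (β γ ϱ : K) (θ : Fin (d + 1) → K)
    (M : Matrix (Fin (d + 1)) (Fin (d + 1)) K) (i j : Fin (d + 1)) :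
    upsElem β γ ϱ (Matrix.diagonal θ) M i j = awPoly β γ ϱ (θ i) (θ j) * M i j := by
  simp only [upsElem, awPoly, Matrix.diagonal_pow, Matrix.sub_apply, Matrix.add_apply,
    Matrix.smul_apply, Matrix.diagonal_mul, Matrix.mul_diagonal, smul_eq_mul, Pi.pow_apply]
  ring

lemma map_upsElem {ℬ : Type*} [Ring ℬ] [Algebra K ℬ] (φ : 𝒜 ≃ₐ[K] ℬ) (β γ ϱ : K) (a X : 𝒜) :
    φ (upsElem β γ ϱ a X) = upsElem β γ ϱ (φ a) (φ X) := by
  simp only [upsElem, map_sub, map_add, map_mul, map_smul, map_pow]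

lemma askeyWilson_iff (s : AWScalars K) : AskeyWilson A As s ↔
    upsElem s.β s.γ s.ϱ A As = s.γs • A ^ 2 + s.ω • A + s.η • (1 : 𝒜) ∧
    upsElem s.β s.γs s.ϱs As A = s.γ • As ^ 2 + s.ω • As + s.ηs • (1 : 𝒜) := Iff.rfl

/-- Interpolation at the eigenvalues gives some polynomial `p` of degree at most `d`. Entry `(deg p,
0)` of `p` evaluated at the irreducible tridiagonal `ψ A` sees only the leading term and is nonzero,
so the band condition bounds `deg p`. -/
lemma Model.exists_aeval (m : Model K A E As Es) {C : 𝒜} {n : ℕ}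
    (hdiag : ∀ i j, i ≠ j → m.φ C i j = 0)
    (hband : ∀ i : Fin (d + 1), n < i → m.ψ C i 0 = 0) :
    ∃ p : Polynomial K, p.natDegree ≤ n ∧ C = Polynomial.aeval A p := by
  classical
  let p := Lagrange.interpolate Finset.univ m.θ (fun i => m.φ C i i)
  have hC : C = Polynomial.aeval A p := by
    apply m.φ.injective
    have : m.φ (Polynomial.aeval A p) = Polynomial.aeval (m.φ A) p :=
      (Polynomial.aeval_algHom_apply m.φ.toAlgHom A _).symm
    rw [this, m.φ_A, aeval_diagonal]
    ext i j
    by_cases hij : i = j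
    · subst hij
      rw [Matrix.diagonal_apply_eq,
        Lagrange.eval_interpolate_at_node _ m.θ_inj.injOn (Finset.mem_univ i)]
    · rw [hdiag i j hij, Matrix.diagonal_apply_ne _ hij]
  refine ⟨p, ?_, hC⟩
  by_contra hlt
  push Not at hlt
  have hp0 : p ≠ 0 := fun h => by simp [h] at hlt
  have hdeg : p.natDegree < d + 1 := by
    have := Lagrange.degree_interpolate_lt (s := Finset.univ) (v := m.θ)
      (fun i => m.φ C i i) m.θ_inj.injOn
    rw [Polynomial.natDegree_lt_iff_degree_lt hp0]
    simpa [p] using this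
  have h0 := hband ⟨p.natDegree, hdeg⟩ hlt
  have : m.ψ (Polynomial.aeval A p) = Polynomial.aeval (m.ψ A) p :=
    (Polynomial.aeval_algHom_apply m.ψ.toAlgHom A _).symm
  rw [hC, this, Polynomial.aeval_eq_sum_range, Matrix.sum_apply,
    Finset.sum_eq_single p.natDegree] at h0
  · rw [Matrix.smul_apply, smul_eq_mul, mul_eq_zero] at h0
    rcases h0 with h0 | h0
    · exact hp0 (Polynomial.leadingCoeff_eq_zero.1 h0)
    · exact pow_apply_ne_zero m.tri_star m.irred_star _ (by simp) h0
  · intro k hk hk'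
    have hk := Finset.mem_range.1 hk
    rw [Matrix.smul_apply, m.tri_star.hasBand_pow k _ _ (by simp; omega), smul_zero]
  · simp

/-- The adjacency graph of the indices is a path, so an antisymmetric function on its edges is a
difference of partial sums. -/
lemma exists_sub_eq_of_adjacent (f : Fin (d + 1) → Fin (d + 1) → K)
    (hf : ∀ i j, f j i = -f i j) :
    ∃ z : Fin (d + 1) → K, ∀ i j, idxDist i j = 1 → z i - z j = f i j := by
  let g : ℕ → K := fun n => if h : n + 1 < d + 1 then f ⟨n + 1, h⟩ ⟨n, by omega⟩ else 0
  have key : ∀ i j : Fin (d + 1), (i : ℕ) = j + 1 →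
      (∑ k ∈ Finset.range i, g k) - (∑ k ∈ Finset.range j, g k) = f i j := by
    intro i j hij
    have hi : (⟨j + 1, by omega⟩ : Fin (d + 1)) = i := Fin.ext hij.symm
    have hj : (j : ℕ) + 1 < d + 1 := by omega
    rw [hij, Finset.sum_range_succ, add_sub_cancel_left]
    simp only [g, dif_pos hj, hi]
  refine ⟨fun i => ∑ k ∈ Finset.range i, g k, fun i j hij => ?_⟩
  rcases idxDist_eq_one_iff.1 hij with h | h
  · exact key i j h
  · rw [← neg_sub, key j i h, hf i j, neg_neg]

/-- In the `A`-eigenbasis both sides only rescale the entries of the tridiagonal `As`, so a diagonal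
`Z` has only to match the factors on adjacent pairs. -/
lemma Model.exists_commutator (m : Model K A E As Es) :
    ∃ Z : 𝒜, (∀ i j, i ≠ j → m.φ Z i j = 0) ∧
      A ^ 2 * As * A - A * As * A ^ 2 = Z * As - As * Z := by
  obtain ⟨z, hz⟩ := exists_sub_eq_of_adjacent
    (fun i j => m.θ i * m.θ j * (m.θ i - m.θ j)) (fun i j => by ring)
  refine ⟨m.φ.symm (Matrix.diagonal z), fun i j hij => ?_, ?_⟩
  · rw [AlgEquiv.apply_symm_apply, Matrix.diagonal_apply_ne _ hij]
  · apply m.φ.injective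
    simp only [map_sub, map_mul, map_pow, m.φ_A, AlgEquiv.apply_symm_apply]
    ext i j
    simp only [Matrix.diagonal_pow, Matrix.sub_apply, Matrix.diagonal_mul, Matrix.mul_diagonal,
      Pi.pow_apply]
    rcases idxDist_trichotomy i j with rfl | h | h
    · ring
    · linear_combination (-m.φ As i j) * hz i j h
    · rw [m.tri i j h]; ring

/-- The last conclusion involves the eigenvalues of the other generator; it is what later identifies
the `β` of the two relations. -/
lemma Model.exists_recurrence (m : Model K A E As Es) {i₀ i₁ i₂ i₃ : Fin (d + 1)}
    (h₀ : i₀ = 0) (h₁ : (i₁ : ℕ) = 1) (h₂ : (i₂ : ℕ) = 2) (h₃ : (i₃ : ℕ) = 3) :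
    ∃ β γ ϱ : K, (∀ i j, idxDist i j = 1 → awPoly β γ ϱ (m.θ i) (m.θ j) = 0) ∧
      (β + 1) * (m.θs i₁ - m.θs i₂) = m.θs i₀ - m.θs i₃ := by
  obtain ⟨Z, hZ, hZA⟩ := m.exists_commutator
  have hv0 : (i₀ : ℕ) = 0 := by simp [h₀]
  set M := m.ψ A with hM
  have b1 : HasBand M 1 := m.tri_star.hasBand
  have b2 : HasBand (M ^ 2) 2 := m.tri_star.hasBand_pow 2
  have bD := hasBand_diagonal m.θs
  have hψ : M ^ 2 * Matrix.diagonal m.θs * M - M * Matrix.diagonal m.θs * M ^ 2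
      = m.ψ Z * Matrix.diagonal m.θs - Matrix.diagonal m.θs * m.ψ Z := by
    simpa only [map_sub, map_mul, map_pow, m.ψ_As] using congrArg m.ψ hZA
  have hband : ∀ i : Fin (d + 1), 3 < (i : ℕ) → m.ψ Z i 0 = 0 := by
    intro i hi
    have h := congrFun (congrFun hψ i) 0
    rw [Matrix.sub_apply, Matrix.sub_apply, ((b2.mul bD).mul b1) i 0 (by simpa using hi),
      ((b1.mul bD).mul b2) i 0 (by simpa using hi), Matrix.mul_diagonal, Matrix.diagonal_mul] at h
    have hne : m.θs 0 - m.θs i ≠ 0 := by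
      rw [sub_ne_zero]
      intro h'
      have := m.θs_inj h'
      rw [← this] at hi
      simp at hi
    refine (mul_eq_zero.1 (?_ : (m.θs 0 - m.θs i) * m.ψ Z i 0 = 0)).resolve_left hne
    linear_combination -h
  obtain ⟨p, hp, hpZ⟩ := m.exists_aeval hZ hband
  rw [Polynomial.aeval_eq_sum_range' (Nat.lt_succ_of_le hp)] at hpZ
  simp only [Nat.succ_eq_add_one, Nat.reduceAdd, Finset.sum_range_succ, Finset.sum_range_zero,
    zero_add, pow_zero, pow_one] at hpZ
  set c0 := p.coeff 0
  set c1 := p.coeff 1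
  set c2 := p.coeff 2
  set c3 := p.coeff 3
  have hψZ : m.ψ Z = c0 • 1 + c1 • M + c2 • M ^ 2 + c3 • M ^ 3 := by
    rw [hpZ]; simp [hM]
  have hne : (M ^ 3) i₃ i₀ ≠ 0 :=
    pow_apply_ne_zero m.tri_star m.irred_star 3 (by omega)
  have e3 : (M ^ 3) i₃ i₀ = M i₃ i₂ * M i₂ i₁ * M i₁ i₀ := by
    rw [pow_succ, b2.mul_apply b1 (r := i₁) (by omega) (by omega), pow_two,
      b1.mul_apply b1 (r := i₂) (by omega) (by omega)]
  -- Entry `(3, 0)` of the commutator identity: only the climbing path contributes, and its common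
  -- product cancels.
  have key : c3 * (m.θs i₀ - m.θs i₃) = m.θs i₁ - m.θs i₂ := by
    have h := congrFun (congrFun hψ i₃) i₀
    have hZ30 : m.ψ Z i₃ i₀ = c3 * (M ^ 3) i₃ i₀ := by
      have h1 : (1 : Matrix (Fin (d + 1)) (Fin (d + 1)) K) i₃ i₀ = 0 :=
        Matrix.one_apply_ne (fun h => by rw [h] at h₃; omega)
      simp [hψZ, b1 i₃ i₀ (by omega), b2 i₃ i₀ (by omega), h1]
    rw [Matrix.sub_apply, Matrix.sub_apply,
      (b2.mul bD).mul_apply b1 (r := i₁) (by omega) (by omega),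
      (b1.mul bD).mul_apply b2 (r := i₂) (by omega) (by omega), Matrix.mul_diagonal,
      Matrix.mul_diagonal, Matrix.mul_diagonal, Matrix.diagonal_mul, hZ30, pow_two,
      b1.mul_apply b1 (r := i₂) (by omega) (by omega),
      b1.mul_apply b1 (r := i₁) (by omega) (by omega)] at h
    apply mul_right_cancel₀ hne
    linear_combination -h - (m.θs i₁ - m.θs i₂) * e3
  have hc3 : c3 ≠ 0 := by
    intro h0
    rw [h0, zero_mul, eq_comm, sub_eq_zero] at key
    have := m.θs_inj key
    rw [this] at h₁; omega
  -- With `x, y` adjacent eigenvalues, the adjacent entries give `xy = c1 + c2 (x + y) + c3 (x² + xy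
  -- + y²)` after dividing by `x - y`. Dividing by `c3` yields these scalars.
  refine ⟨1 / c3 - 1, -c2 / c3, -c1 / c3, fun i j hij => ?_, ?_⟩
  · have h := congrFun (congrFun (congrArg m.φ hZA) i) j
    have hφZ : m.φ Z = Matrix.diagonal
        (fun i => c0 + c1 * m.θ i + c2 * m.θ i ^ 2 + c3 * m.θ i ^ 3) := by
      rw [hpZ]
      simp only [map_add, map_smul, map_one, map_pow, m.φ_A, Matrix.diagonal_pow]
      ext i j
      by_cases hij : i = j
      · subst hij; simp
      · simp [hij]
    simp only [map_sub, map_mul, map_pow, m.φ_A, hφZ, Matrix.diagonal_pow, Matrix.sub_apply,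
      Matrix.diagonal_mul, Matrix.mul_diagonal, Pi.pow_apply] at h
    have hθ : m.θ i - m.θ j ≠ 0 := by
      rw [sub_ne_zero]
      intro h'
      rw [m.θ_inj h'] at hij
      simp [idxDist] at hij
    have hx : (m.θ i - m.θ j) * m.φ As i j ≠ 0 := mul_ne_zero hθ (m.irred i j hij)
    have : c3 * awPoly (1 / c3 - 1) (-c2 / c3) (-c1 / c3) (m.θ i) (m.θ j) = 0 := by
      have e : c3 * awPoly (1 / c3 - 1) (-c2 / c3) (-c1 / c3) (m.θ i) (m.θ j) =
          c3 * (m.θ i ^ 2 + m.θ i * m.θ j + m.θ j ^ 2) - m.θ i * m.θ j + c2 * (m.θ i + m.θ j)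
            + c1 := by
        rw [awPoly]; field_simp; ring
      rw [e]
      apply mul_right_cancel₀ hx
      linear_combination -h
    exact (mul_eq_zero.1 this).resolve_left hc3
  · field_simp
    linear_combination -key

/-- The difference of the two quadratic relations is divisible by `x - z`. -/
lemma awPoly_consecutive {β γ ϱ x y z : K} (h₁ : awPoly β γ ϱ x y = 0)
    (h₂ : awPoly β γ ϱ y z = 0) (h : x ≠ z) : γ = x - β * y + z := by
  apply mul_left_cancel₀ (sub_ne_zero.2 h)
  rw [awPoly] at h₁ h₂
  linear_combination h₂ - h₁

end Recurrence

/-! ### Existence and uniqueness of the Askey-Wilson scalars. -/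

section AskeyWilsonRelations

variable {K : Type*} [Field K] {𝒜 : Type*} [Ring 𝒜] [Algebra K 𝒜] {d : ℕ}
  {A As : 𝒜} {E Es : Fin (d + 1) → 𝒜}

lemma Model.awPoly_eq_zero (m : Model K A E As Es) {β γ ϱ c₂ c₁ c₀ : K}
    (h : upsElem β γ ϱ A As = c₂ • A ^ 2 + c₁ • A + c₀ • (1 : 𝒜)) (i j : Fin (d + 1))
    (hij : idxDist i j = 1) : awPoly β γ ϱ (m.θ i) (m.θ j) = 0 := by
  have hne : i ≠ j := by rintro rfl; simp [idxDist] at hij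
  have h' := congrFun (congrFun (congrArg m.φ h) i) j
  rw [map_upsElem, m.φ_A, upsElem_diagonal_apply] at h'
  simp only [map_add, map_smul, map_pow, map_one, m.φ_A, Matrix.diagonal_pow, Matrix.add_apply,
    Matrix.smul_apply, Matrix.diagonal_apply_ne _ hne, Matrix.one_apply_ne hne, smul_zero,
    add_zero] at h'
  exact (mul_eq_zero.1 h').resolve_right (m.irred i j hij)

/-- The recurrence kills the entries next to the diagonal, so `Υ(As)` is a polynomial in `A`, of
degree at most 2 by its band in the other model. Its leading coefficient is read from entry `(2,
0)`; by `awPoly_consecutive` for `As` it is the required `γ*`. -/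
lemma Model.exists_askeyWilson_half (m : Model K A E As Es) {i₁ i₂ : Fin (d + 1)}
    (h₁ : (i₁ : ℕ) = 1) (h₂ : (i₂ : ℕ) = 2) {β γ ϱ : K}
    (hP : ∀ i j, idxDist i j = 1 → awPoly β γ ϱ (m.θ i) (m.θ j) = 0) :
    ∃ ω η : K, upsElem β γ ϱ A As =
      (m.θs 0 - β * m.θs i₁ + m.θs i₂) • A ^ 2 + ω • A + η • (1 : 𝒜) := by
  set M := m.ψ A with hM
  have b1 : HasBand M 1 := m.tri_star.hasBand
  have b2 : HasBand (M ^ 2) 2 := m.tri_star.hasBand_pow 2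
  have bD := hasBand_diagonal m.θs
  have hentry : ∀ i : Fin (d + 1), 1 < (i : ℕ) → m.ψ (upsElem β γ ϱ A As) i 0 =
      (M ^ 2) i 0 * m.θs 0 - β * (M * Matrix.diagonal m.θs * M) i 0
        + m.θs i * (M ^ 2) i 0 := by
    intro i hi
    have hi0 : i ≠ 0 := by rintro rfl; simp at hi
    rw [map_upsElem, m.ψ_As, upsElem, ← hM]
    simp only [Matrix.sub_apply, Matrix.add_apply, Matrix.smul_apply, Matrix.mul_diagonal,
      Matrix.diagonal_mul, b1 i 0 (by simpa using hi), Matrix.diagonal_apply_ne _ hi0,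
      smul_eq_mul]
    ring
  obtain ⟨p, hp, hpC⟩ := m.exists_aeval (C := upsElem β γ ϱ A As) (n := 2)
    (fun i j hij => by
      rw [map_upsElem, m.φ_A, upsElem_diagonal_apply]
      rcases idxDist_trichotomy i j with h | h | h
      · exact absurd h hij
      · rw [hP i j h, zero_mul]
      · rw [m.tri i j h, mul_zero])
    (fun i hi => by
      rw [hentry i (by omega), b2 i 0 (by simpa using hi),
        ((b1.mul bD).mul b1) i 0 (by simpa using hi)]
      ring)
  rw [Polynomial.aeval_eq_sum_range' (Nat.lt_succ_of_le hp)] at hpC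
  simp only [Nat.succ_eq_add_one, Nat.reduceAdd, Finset.sum_range_succ, Finset.sum_range_zero,
    zero_add, pow_zero, pow_one] at hpC
  have key : p.coeff 2 = m.θs 0 - β * m.θs i₁ + m.θs i₂ := by
    have h := hentry i₂ (by omega)
    have h20 : i₂ ≠ 0 := by rintro rfl; simp at h₂
    have hne : (M ^ 2) i₂ 0 ≠ 0 := pow_apply_ne_zero m.tri_star m.irred_star 2 (by simpa using h₂)
    have e2 : (M ^ 2) i₂ 0 = M i₂ i₁ * M i₁ 0 := by
      rw [pow_two, b1.mul_apply b1 (r := i₁) (by simpa using h₁) (by omega)]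
    rw [hpC] at h
    simp only [map_add, map_smul, map_pow, map_one, Matrix.add_apply, Matrix.smul_apply, ← hM,
      Matrix.one_apply_ne h20, b1 i₂ 0 (by simp [h₂]), smul_eq_mul,
      (b1.mul bD).mul_apply b1 (r := i₁) (i := i₂) (j := 0) (by simpa using h₁) (by omega),
      Matrix.mul_diagonal] at h
    apply mul_right_cancel₀ hne
    linear_combination h + β * m.θs i₁ * e2
  refine ⟨p.coeff 1, p.coeff 0, ?_⟩
  rw [hpC, ← key]
  abel

/-- In `[Υ(As), As] + [Υ*(A), A]` the quartic terms and the `ϱ` terms cancel. Inserting the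
right-hand sides of the relations leaves only the mismatch of the linear coefficients. -/
lemma smul_commutator_eq_zero {β γ ϱ γs ϱs ω η ωs ηs : K}
    (h : upsElem β γ ϱ A As = γs • A ^ 2 + ω • A + η • (1 : 𝒜))
    (hs : upsElem β γs ϱs As A = γ • As ^ 2 + ωs • As + ηs • (1 : 𝒜)) :
    (ω - ωs) • (A * As - As * A) = 0 := by
  have h1 : upsElem β γ ϱ A As * As - As * upsElem β γ ϱ A As +
      (upsElem β γs ϱs As A * A - A * upsElem β γs ϱs As A) =
      γs • (A ^ 2 * As - As * A ^ 2) + γ • (As ^ 2 * A - A * As ^ 2) := by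
    simp only [upsElem, sub_mul, mul_sub, add_mul, mul_add, smul_mul_assoc, mul_smul_comm,
      pow_two, mul_assoc, smul_add]
    module
  rw [h, hs] at h1
  simp only [add_mul, mul_add, smul_mul_assoc, mul_smul_comm, one_mul,
    mul_one] at h1
  linear_combination (norm := module) h1

lemma Model.commutator_ne_zero (m : Model K A E As Es) (hd : 1 ≤ d) :
    A * As - As * A ≠ 0 := by
  intro h
  have h' := congrFun (congrFun (congrArg m.ψ h) ⟨1, by omega⟩) 0
  have hne := m.irred_star ⟨1, by omega⟩ 0 (by simp [idxDist])
  simp only [map_sub, map_mul, m.ψ_As, Matrix.sub_apply, Matrix.mul_diagonal,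
    Matrix.diagonal_mul, map_zero, Matrix.zero_apply] at h'
  have : m.ψ A ⟨1, by omega⟩ 0 * (m.θs 0 - m.θs ⟨1, by omega⟩) = 0 := by linear_combination h'
  have := m.θs_inj (sub_eq_zero.1 ((mul_eq_zero.1 this).resolve_left hne))
  simp [Fin.ext_iff] at this

lemma Model.exists_askeyWilson (m : Model K A E As Es) (hd : 3 ≤ d) :
    ∃ s : AWScalars K, AskeyWilson A As s := by
  obtain ⟨i₁, h₁⟩ : ∃ i : Fin (d + 1), (i : ℕ) = 1 := ⟨⟨1, by omega⟩, rfl⟩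
  obtain ⟨i₂, h₂⟩ : ∃ i : Fin (d + 1), (i : ℕ) = 2 := ⟨⟨2, by omega⟩, rfl⟩
  obtain ⟨i₃, h₃⟩ : ∃ i : Fin (d + 1), (i : ℕ) = 3 := ⟨⟨3, by omega⟩, rfl⟩
  obtain ⟨β, γ, ϱ, hP, hβ⟩ := m.exists_recurrence rfl h₁ h₂ h₃
  obtain ⟨β', γs, ϱs, hPs, hβ'⟩ := m.swap.exists_recurrence rfl h₁ h₂ h₃
  change (β' + 1) * (m.θ i₁ - m.θ i₂) = m.θ 0 - m.θ i₃ at hβ'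
  change ∀ i j, idxDist i j = 1 → awPoly β' γs ϱs (m.θs i) (m.θs j) = 0 at hPs
  have d01 : idxDist 0 i₁ = 1 := idxDist_eq_one_iff.2 (by simp [h₁])
  have d12 : idxDist i₁ i₂ = 1 := idxDist_eq_one_iff.2 (by omega)
  have d23 : idxDist i₂ i₃ = 1 := idxDist_eq_one_iff.2 (by omega)
  have n02 : 0 ≠ i₂ := by rintro rfl; simp at h₂
  have n13 : i₁ ≠ i₃ := by rintro rfl; omega
  have n12 : i₁ ≠ i₂ := by rintro rfl; omega
  have g1 := awPoly_consecutive (hP _ _ d01) (hP _ _ d12) (m.θ_inj.ne n02)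
  have g2 := awPoly_consecutive (hP _ _ d12) (hP _ _ d23) (m.θ_inj.ne n13)
  have g1s := awPoly_consecutive (hPs _ _ d01) (hPs _ _ d12) (m.θs_inj.ne n02)
  -- Equating the two expressions for `γ` gives `(β + 1)(θ₁ - θ₂) = θ₀ - θ₃`, the equation that `β'`
  -- satisfies.
  obtain rfl : β = β' := by
    apply mul_right_cancel₀ (sub_ne_zero.2 (m.θ_inj.ne n12))
    linear_combination g1 - g2 - hβ'
  obtain ⟨ω, η, hA⟩ := m.exists_askeyWilson_half h₁ h₂ hP
  obtain ⟨ωs, ηs, hAs⟩ := m.swap.exists_askeyWilson_half h₁ h₂ hPs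
  change _ = (m.θ 0 - β * m.θ i₁ + m.θ i₂) • As ^ 2 + ωs • As + ηs • (1 : 𝒜) at hAs
  rw [← g1s] at hA
  rw [← g1] at hAs
  have hω := (smul_eq_zero.1 (smul_commutator_eq_zero hA hAs)).resolve_right
    (m.commutator_ne_zero (by omega))
  rw [sub_eq_zero] at hω
  subst hω
  exact ⟨⟨β, γ, γs, ϱ, ϱs, ω, η, ηs⟩, (askeyWilson_iff _).2 ⟨hA, hAs⟩⟩

lemma Model.smul_add_smul_one_eq_zero (m : Model K A E As Es) (hd : 1 ≤ d) {a b : K}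
    (h : a • A + b • (1 : 𝒜) = 0) : a = 0 ∧ b = 0 := by
  have key : ∀ i, a * m.θ i + b = 0 := fun i => by
    simpa [m.φ_A] using congrFun (congrFun (congrArg m.φ h) i) i
  have hne : m.θ 0 - m.θ ⟨1, by omega⟩ ≠ 0 := by
    rw [sub_ne_zero]
    intro h
    simpa [Fin.ext_iff] using m.θ_inj h
  have ha : a = 0 := by
    refine (mul_eq_zero.1 (?_ : a * (m.θ 0 - m.θ ⟨1, by omega⟩) = 0)).resolve_right hne
    linear_combination key 0 - key ⟨1, by omega⟩
  refine ⟨ha, ?_⟩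
  simpa [ha] using key 0

lemma Model.recurrence_unique (m : Model K A E As Es) (hd : 3 ≤ d) {β γ ϱ β' γ' ϱ' : K}
    (h : ∀ i j, idxDist i j = 1 → awPoly β γ ϱ (m.θ i) (m.θ j) = 0)
    (h' : ∀ i j, idxDist i j = 1 → awPoly β' γ' ϱ' (m.θ i) (m.θ j) = 0) :
    β = β' ∧ γ = γ' ∧ ϱ = ϱ' := by
  obtain ⟨i₁, h₁⟩ : ∃ i : Fin (d + 1), (i : ℕ) = 1 := ⟨⟨1, by omega⟩, rfl⟩
  obtain ⟨i₂, h₂⟩ : ∃ i : Fin (d + 1), (i : ℕ) = 2 := ⟨⟨2, by omega⟩, rfl⟩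
  obtain ⟨i₃, h₃⟩ : ∃ i : Fin (d + 1), (i : ℕ) = 3 := ⟨⟨3, by omega⟩, rfl⟩
  have d01 : idxDist 0 i₁ = 1 := idxDist_eq_one_iff.2 (by simp [h₁])
  have d12 : idxDist i₁ i₂ = 1 := idxDist_eq_one_iff.2 (by omega)
  have d23 : idxDist i₂ i₃ = 1 := idxDist_eq_one_iff.2 (by omega)
  have n02 : 0 ≠ i₂ := by rintro rfl; simp at h₂
  have n13 : i₁ ≠ i₃ := by rintro rfl; omega
  have n12 : i₁ ≠ i₂ := by rintro rfl; omega
  have g1 := awPoly_consecutive (h _ _ d01) (h _ _ d12) (m.θ_inj.ne n02)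
  have g2 := awPoly_consecutive (h _ _ d12) (h _ _ d23) (m.θ_inj.ne n13)
  have g1' := awPoly_consecutive (h' _ _ d01) (h' _ _ d12) (m.θ_inj.ne n02)
  have g2' := awPoly_consecutive (h' _ _ d12) (h' _ _ d23) (m.θ_inj.ne n13)
  obtain rfl : β = β' := by
    apply mul_right_cancel₀ (sub_ne_zero.2 (m.θ_inj.ne n12))
    linear_combination g1 - g2 - g1' + g2'
  obtain rfl : γ = γ' := by rw [g1, g1']
  have e := h _ _ d01
  have e' := h' _ _ d01
  rw [awPoly] at e e'
  exact ⟨rfl, rfl, by linear_combination e' - e⟩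

lemma Model.existsUnique_askeyWilson (m : Model K A E As Es) (hd : 3 ≤ d) :
    ∃! s : AWScalars K, AskeyWilson A As s := by
  refine existsUnique_of_exists_of_unique (m.exists_askeyWilson hd) fun s t hs ht => ?_
  rw [askeyWilson_iff] at hs ht
  obtain ⟨hβ, hγ, hϱ⟩ := m.recurrence_unique hd (m.awPoly_eq_zero hs.1) (m.awPoly_eq_zero ht.1)
  obtain ⟨-, hγs, hϱs⟩ := m.swap.recurrence_unique hd (m.swap.awPoly_eq_zero hs.2)
    (m.swap.awPoly_eq_zero ht.2)
  have e := hs.1.symm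
  have es := hs.2.symm
  rw [hβ, hγ, hϱ, ht.1, hγs] at e
  rw [hβ, hγs, hϱs, ht.2, hγ] at es
  obtain ⟨hω, hη⟩ := m.smul_add_smul_one_eq_zero (by omega)
    (a := s.ω - t.ω) (b := s.η - t.η) (by linear_combination (norm := module) e)
  obtain ⟨-, hηs⟩ := m.swap.smul_add_smul_one_eq_zero (by omega)
    (a := s.ω - t.ω) (b := s.ηs - t.ηs) (by linear_combination (norm := module) es)
  exact AWScalars.ext hβ hγ hγs hϱ hϱs (sub_eq_zero.1 hω) (sub_eq_zero.1 hη) (sub_eq_zero.1 hηs)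

end AskeyWilsonRelations

/-! ### Consequences of a zero diagonal. -/

section Bipartite

variable {K : Type*} [Field K] {𝒜 : Type*} [Ring 𝒜] [Algebra K 𝒜] {d : ℕ}
  {A As : 𝒜} {E Es : Fin (d + 1) → 𝒜}

open Matrix in
-- The vectors `M ^ k e₀` are triangular in the standard basis with nonzero leading entries, so they
-- span.
lemma eq_zero_of_mulVec_pow {M N : Matrix (Fin (d + 1)) (Fin (d + 1)) K} (hM : IsTri M)
    (hM' : IsIrred M) (h : ∀ k, N *ᵥ (M ^ k *ᵥ Pi.single 0 1) = 0) : N = 0 := by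
  have key : ∀ (n : ℕ) (j : Fin (d + 1)), (j : ℕ) = n → ∀ i, N i j = 0 := by
    intro n
    induction n using Nat.strong_induction_on with
    | _ n ih =>
      intro j hj i
      have hk := congrFun (h n) i
      rw [mulVec_single_one, mulVec, dotProduct, Finset.sum_eq_single j] at hk
      · exact (mul_eq_zero.1 hk).resolve_right
          (pow_apply_ne_zero hM hM' n (by simpa using hj))
      · intro k _ hkj
        rcases lt_or_ge (k : ℕ) n with hlt | hge
        · rw [ih k hlt k rfl i, zero_mul]
        · have : (k : ℕ) ≠ j := fun h => hkj (Fin.ext h)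
          rw [col_apply, hM.hasBand_pow n k 0 (by simp; omega), mul_zero]
      · simp
  ext i j
  exact key j j rfl i

open Matrix in
/-- A tridiagonal `N` whose two first columns vanish is zero if
`M²N - βMNM + NM² - ϱN` commutes with the irreducible tridiagonal matrix `M` of zero diagonal. -/
lemma eq_zero_of_commute_upsElem (hd : 3 ≤ d) {M N : Matrix (Fin (d + 1)) (Fin (d + 1)) K}
    {β ϱ : K} (hβ : β ≠ 0) (hβ' : β + 1 ≠ 0) (hM : IsTri M) (hM' : IsIrred M)
    (hM0 : ∀ i, M i i = 0) (hN : IsTri N) (hN0 : ∀ i, N i 0 = 0)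
    (hN1 : ∀ i j : Fin (d + 1), (j : ℕ) = 1 → N i j = 0)
    (hQ : upsElem β 0 ϱ M N * M = M * upsElem β 0 ϱ M N) : N = 0 := by
  obtain ⟨i₁, h₁⟩ : ∃ i : Fin (d + 1), (i : ℕ) = 1 := ⟨⟨1, by omega⟩, rfl⟩
  obtain ⟨i₂, h₂⟩ : ∃ i : Fin (d + 1), (i : ℕ) = 2 := ⟨⟨2, by omega⟩, rfl⟩
  obtain ⟨i₃, h₃⟩ : ∃ i : Fin (d + 1), (i : ℕ) = 3 := ⟨⟨3, by omega⟩, rfl⟩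
  set Q := upsElem β 0 ϱ M N with hQdef
  set v : Fin (d + 1) → K := Pi.single 0 1 with hv
  have hQv : ∀ y, Q *ᵥ y = M *ᵥ (M *ᵥ (N *ᵥ y)) - β • (M *ᵥ (N *ᵥ (M *ᵥ y)))
      + N *ᵥ (M *ᵥ (M *ᵥ y)) - ϱ • (N *ᵥ y) := by
    intro y
    simp only [hQdef, upsElem, zero_smul, sub_zero, sub_mulVec, add_mulVec, smul_mulVec,
      mulVec_mulVec, pow_two, mul_assoc]
  have hQM : ∀ y, Q *ᵥ (M *ᵥ y) = M *ᵥ (Q *ᵥ y) := by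
    intro y; rw [mulVec_mulVec, mulVec_mulVec, hQ]
  have hv0 : N *ᵥ v = 0 := by
    ext i; simp [hv, hN0]
  have hsmall : ∀ k : Fin (d + 1), (k : ℕ) < 2 → ∀ i, N i k = 0 := by
    intro k hk i
    rcases Nat.lt_or_ge (k : ℕ) 1 with hk' | hk'
    · obtain rfl : k = 0 := Fin.ext (by rw [Fin.val_zero]; omega)
      exact hN0 i
    · exact hN1 i k (by omega)
  have hv1 : N *ᵥ (M *ᵥ v) = 0 := by
    ext i
    rw [mulVec, dotProduct]
    refine Finset.sum_eq_zero fun k _ => ?_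
    rcases Nat.lt_or_ge (k : ℕ) 2 with hk | hk
    · rw [hsmall k hk, zero_mul]
    · rw [hv, mulVec_single_one, col_apply, hM.hasBand k 0 (by simp; omega), mul_zero]
  -- `w` measures the first failure of `N` to vanish on the Krylov vectors `M ^ k v`. Commutation of
  -- `Q` with `M` expresses `N M³ v` and `N M⁴ v` through `w`; the zero rows of `N` then remove the
  -- entries of `w` one at a time.
  obtain ⟨w, hw⟩ : ∃ w, w = N *ᵥ (M *ᵥ (M *ᵥ v)) := ⟨_, rfl⟩
  have q0 : Q *ᵥ v = w := by
    rw [hQv, hv0, hv1, ← hw]; simp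
  have q1 : N *ᵥ (M *ᵥ (M *ᵥ (M *ᵥ v))) = (1 + β) • (M *ᵥ w) := by
    have h := hQM v
    rw [q0, hQv, hv1, ← hw] at h
    simp only [mulVec_zero, smul_zero] at h
    linear_combination (norm := module) h
  have q2 : N *ᵥ (M *ᵥ (M *ᵥ (M *ᵥ (M *ᵥ v)))) =
      (β * (1 + β)) • (M *ᵥ (M *ᵥ w)) + ϱ • w := by
    have h := hQM (M *ᵥ v)
    rw [hQM v, q0, hQv, ← hw, q1] at h
    simp only [mulVec_smul] at h
    linear_combination (norm := module) h
  have hfar : ∀ {L : Matrix (Fin (d + 1)) (Fin (d + 1)) K}, IsTri L → ∀ i j : Fin (d + 1),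
      ((j : ℕ) + 1 < i ∨ (i : ℕ) + 1 < j) → L i j = 0 :=
    fun hL i j h => hL i j (one_lt_idxDist_iff.2 h)
  have hadj : ∀ i j : Fin (d + 1), ((i : ℕ) = j + 1 ∨ (j : ℕ) = i + 1) → M i j ≠ 0 :=
    fun i j h => hM' i j (idxDist_eq_one_iff.2 h)
  have hw_apply : ∀ i, w i = N i i₂ * (M ^ 2) i₂ 0 := by
    intro i
    rw [hw, mulVec_mulVec v M M, ← pow_two, hv, mulVec_single_one, mulVec, dotProduct,
      Finset.sum_eq_single i₂]
    · rfl
    · intro k _ hk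
      have hk' : (k : ℕ) ≠ i₂ := fun h => hk (Fin.ext h)
      rcases Nat.lt_or_ge (k : ℕ) 2 with hk2 | hk2
      · rw [hsmall k hk2, zero_mul]
      · rw [col_apply, hM.hasBand_pow 2 k 0 (by simp; omega), mul_zero]
    · simp
  have hM2 : (M ^ 2) i₂ 0 ≠ 0 := pow_apply_ne_zero hM hM' 2 (by simpa using h₂)
  have row : ∀ i, (∀ k, N i k = 0) → ∀ y, (N *ᵥ y) i = 0 := by
    intro i hi y
    rw [mulVec, dotProduct]
    exact Finset.sum_eq_zero fun k _ => by rw [hi, zero_mul]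
  have row0 : ∀ k, N 0 k = 0 := by
    intro k
    rcases Nat.lt_or_ge (k : ℕ) 2 with hk | hk
    · exact hsmall k hk 0
    · exact hfar hN 0 k (by simp; omega)
  have hβ1 : 1 + β ≠ 0 := by rwa [add_comm]
  have Mw : ∀ i, (N *ᵥ (M *ᵥ (M *ᵥ (M *ᵥ v)))) i = 0 → (M *ᵥ w) i = 0 := by
    intro i hi
    rw [q1, Pi.smul_apply, smul_eq_mul] at hi
    exact (mul_eq_zero.1 hi).resolve_left hβ1
  have Mw0 : (M *ᵥ w) 0 = 0 := Mw 0 (row 0 row0 _)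
  have w1 : w i₁ = 0 := by
    have h := Mw0
    rw [mulVec, dotProduct, Finset.sum_eq_single i₁] at h
    · exact (mul_eq_zero.1 h).resolve_left (hadj _ _ (by simp [h₁]))
    · intro k _ hk
      have hk' : (k : ℕ) ≠ i₁ := fun h => hk (Fin.ext h)
      rcases Nat.lt_or_ge (k : ℕ) 1 with h | h
      · obtain rfl : k = 0 := Fin.ext (by rw [Fin.val_zero]; omega)
        rw [hM0, zero_mul]
      · rw [hfar hM 0 k (by simp; omega), zero_mul]
    · simp
  have w0 : w 0 = 0 := by rw [hw]; exact row 0 row0 _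
  have row1 : ∀ k, N i₁ k = 0 := by
    intro k
    rcases Nat.lt_or_ge (k : ℕ) 2 with hk | hk
    · exact hsmall k hk i₁
    · rcases eq_or_ne k i₂ with rfl | hk2
      · rw [hw_apply] at w1
        exact (mul_eq_zero.1 w1).resolve_right hM2
      · have hk' : (k : ℕ) ≠ i₂ := fun h => hk2 (Fin.ext h)
        exact hfar hN _ _ (by omega)
  have Mw1 : (M *ᵥ w) i₁ = 0 := Mw i₁ (row i₁ row1 _)
  have w2 : w i₂ = 0 := by
    have h := Mw1
    rw [mulVec, dotProduct, Finset.sum_eq_single i₂] at h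
    · exact (mul_eq_zero.1 h).resolve_left (hadj _ _ (by omega))
    · intro k _ hk
      have hk' : (k : ℕ) ≠ i₂ := fun h => hk (Fin.ext h)
      rcases Nat.lt_or_ge (k : ℕ) 1 with h | h
      · obtain rfl : k = 0 := Fin.ext (by rw [Fin.val_zero]; omega)
        rw [w0, mul_zero]
      · rcases Nat.lt_or_ge (k : ℕ) 2 with h' | h'
        · obtain rfl : k = i₁ := Fin.ext (by omega)
          rw [hM0, zero_mul]
        · rw [hfar hM i₁ k (by omega), zero_mul]
    · simp
  have wne : ∀ k, k ≠ i₃ → w k = 0 := by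
    intro k hk
    have hk' : (k : ℕ) ≠ i₃ := fun h => hk (Fin.ext h)
    rcases Nat.lt_or_ge (k : ℕ) 1 with h | h
    · obtain rfl : k = 0 := Fin.ext (by rw [Fin.val_zero]; omega)
      exact w0
    · rcases Nat.lt_or_ge (k : ℕ) 2 with h' | h'
      · obtain rfl : k = i₁ := Fin.ext (by omega)
        exact w1
      · rcases Nat.lt_or_ge (k : ℕ) 3 with h'' | h''
        · obtain rfl : k = i₂ := Fin.ext (by omega)
          exact w2
        · rw [hw_apply, hfar hN k i₂ (by omega), zero_mul]
  -- Row 1 of `N M⁴ v` is `β (1 + β) (M² w)₁`, the `ϱ` term dropping out because `w₁ = 0`. As `(M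
  -- w)₀ = 0`, this entry isolates `w₃`.
  have w3 : w i₃ = 0 := by
    have h := row i₁ row1 (M *ᵥ (M *ᵥ (M *ᵥ (M *ᵥ v))))
    rw [q2, Pi.add_apply, Pi.smul_apply, Pi.smul_apply, w1, smul_zero, add_zero, smul_eq_mul] at h
    have h := (mul_eq_zero.1 h).resolve_left (mul_ne_zero hβ hβ1)
    rw [mulVec, dotProduct, Finset.sum_eq_single i₂] at h
    · have h := (mul_eq_zero.1 h).resolve_left (hadj _ _ (by omega))
      rw [mulVec, dotProduct, Finset.sum_eq_single i₃] at h
      · exact (mul_eq_zero.1 h).resolve_left (hadj _ _ (by omega))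
      · intro k _ hk
        rw [wne k hk, mul_zero]
      · simp
    · intro k _ hk
      have hk' : (k : ℕ) ≠ i₂ := fun h => hk (Fin.ext h)
      rcases Nat.lt_or_ge (k : ℕ) 1 with h | h
      · obtain rfl : k = 0 := Fin.ext (by rw [Fin.val_zero]; omega)
        rw [Mw0, mul_zero]
      · rcases Nat.lt_or_ge (k : ℕ) 2 with h' | h'
        · obtain rfl : k = i₁ := Fin.ext (by omega)
          rw [hM0, zero_mul]
        · rw [hfar hM i₁ k (by omega), zero_mul]
    · simp
  have hw0 : w = 0 := by
    ext k
    by_cases hk : k = i₃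
    · rw [hk, w3, Pi.zero_apply]
    · rw [wne k hk, Pi.zero_apply]
  have hQk : ∀ k, Q *ᵥ (M ^ k *ᵥ v) = 0 := by
    intro k
    induction k with
    | zero => simp [q0, hw0]
    | succ k ih => rw [pow_succ', ← mulVec_mulVec, hQM, ih, mulVec_zero]
  have hNk : ∀ k, N *ᵥ (M ^ k *ᵥ v) = 0 ∧ N *ᵥ (M ^ (k + 1) *ᵥ v) = 0 := by
    intro k
    induction k with
    | zero => exact ⟨by simpa using hv0, by simpa using hv1⟩
    | succ k ih =>
      refine ⟨ih.2, ?_⟩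
      have h := hQk k
      have e1 : M *ᵥ (M ^ k *ᵥ v) = M ^ (k + 1) *ᵥ v := by rw [pow_succ', ← mulVec_mulVec]
      have e2 : M *ᵥ (M ^ (k + 1) *ᵥ v) = M ^ (k + 1 + 1) *ᵥ v := by
        rw [pow_succ' M (k + 1), ← mulVec_mulVec]
      rw [hQv, e1, e2, ih.1, ih.2] at h
      simpa using h
  exact eq_zero_of_mulVec_pow hM hM' fun k => (hNk k).1

/-- The left side has zero diagonal in the `As`-eigenbasis, so the quadratic on the right vanishes
at three distinct eigenvalues. -/
lemma Model.bipartite_coeffs (m : Model K A E As Es) (hd : 2 ≤ d) (hb : ∀ i, m.ψ A i i = 0)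
    {β γs ϱs c₂ c₁ c₀ : K}
    (h : upsElem β γs ϱs As A = c₂ • As ^ 2 + c₁ • As + c₀ • (1 : 𝒜)) :
    c₂ = 0 ∧ c₁ = 0 ∧ c₀ = 0 := by
  have key : ∀ i, c₂ * m.θs i ^ 2 + c₁ * m.θs i + c₀ = 0 := by
    intro i
    have h' := congrFun (congrFun (congrArg m.ψ h) i) i
    rw [map_upsElem, m.ψ_As, upsElem_diagonal_apply, hb, mul_zero] at h'
    simpa [m.ψ_As, Matrix.diagonal_pow] using h'.symm
  have hne : ∀ a b (ha : a < d + 1) (hb : b < d + 1), a ≠ b →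
      m.θs ⟨a, ha⟩ - m.θs ⟨b, hb⟩ ≠ 0 := by
    intro a b ha hb hab
    rw [sub_ne_zero]
    intro h
    exact hab (by simpa using m.θs_inj h)
  have n01 := hne 0 1 (by omega) (by omega) (by omega)
  have n02 := hne 0 2 (by omega) (by omega) (by omega)
  have n12 := hne 1 2 (by omega) (by omega) (by omega)
  have k0 := key ⟨0, by omega⟩
  have k1 := key ⟨1, by omega⟩
  have k2 := key ⟨2, by omega⟩
  generalize m.θs ⟨0, by omega⟩ = x at *
  generalize m.θs ⟨1, by omega⟩ = y at *
  generalize m.θs ⟨2, by omega⟩ = z at *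
  have a1 : c₂ * (x + y) + c₁ = 0 := by
    apply mul_left_cancel₀ n01; linear_combination k0 - k1
  have a2 : c₂ * (y + z) + c₁ = 0 := by
    apply mul_left_cancel₀ n12; linear_combination k1 - k2
  have hc2 : c₂ = 0 := by
    apply mul_left_cancel₀ n02; linear_combination a1 - a2
  have hc1 : c₁ = 0 := by linear_combination a1 - (x + y) * hc2
  exact ⟨hc2, hc1, by linear_combination k0 - x ^ 2 * hc2 - x * hc1⟩

/-- The sign involution of a bipartite system cannot exist when `θ₂ = -θ₀` and `θ₃ = -θ₁`. -/
lemma Model.bipartite_ne (m : Model K A E As Es) (hb : ∀ i, m.ψ A i i = 0)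
    {i₁ i₂ i₃ : Fin (d + 1)} (h₁ : (i₁ : ℕ) = 1) (h₂ : (i₂ : ℕ) = 2) (h₃ : (i₃ : ℕ) = 3)
    (h02 : m.θ i₂ = -m.θ 0) (h13 : m.θ i₃ = -m.θ i₁) : False := by
  let σ : Matrix (Fin (d + 1)) (Fin (d + 1)) K := Matrix.diagonal fun i => (-1) ^ (i : ℕ)
  obtain ⟨S, hS⟩ : ∃ S, m.ψ S = σ := m.ψ.surjective σ
  have hSS : S * S = 1 := by
    apply m.ψ.injective
    rw [map_mul, hS, map_one, Matrix.diagonal_mul_diagonal, ← Matrix.diagonal_one]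
    congr 1
    ext i
    rw [← pow_add, ← two_mul, pow_mul]; simp
  have hSA : S * A = -(A * S) := by
    apply m.ψ.injective
    rw [map_neg, map_mul, map_mul, hS]
    ext i j
    rw [Matrix.neg_apply, Matrix.diagonal_mul, Matrix.mul_diagonal]
    rcases idxDist_trichotomy i j with rfl | h | h
    · simp [hb]
    · rcases idxDist_eq_one_iff.1 h with h | h <;> rw [h, pow_succ] <;> ring
    · simp [m.tri_star i j h]
  have hSAs : S * As = As * S := by
    apply m.ψ.injective
    rw [map_mul, map_mul, hS, m.ψ_As, Matrix.diagonal_mul_diagonal, Matrix.diagonal_mul_diagonal]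
    congr 1
    ext i
    ring
  obtain ⟨s, hs⟩ : ∃ s, s = m.φ S := ⟨_, rfl⟩
  have hs0 : ∀ i j, s i j ≠ 0 → m.θ i = -m.θ j := by
    intro i j hij
    have h := congrFun (congrFun (congrArg m.φ hSA) i) j
    rw [map_neg, map_mul, map_mul, m.φ_A, Matrix.neg_apply, Matrix.mul_diagonal,
      Matrix.diagonal_mul, ← hs] at h
    apply mul_left_cancel₀ hij
    linear_combination h
  -- Since `S` negates eigenvalues of `A`, row 0 of `s` lives in column 2 and column 1 in row 3.
  -- Entry `(0, 1)` of `S As = As S` thus reads `s₀₂ As₂₁ = As₀₃ s₃₁ = 0`, so row 0 of the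
  -- invertible `s` vanishes.
  have hsb := congrFun (congrFun (congrArg m.φ hSAs) 0) i₁
  rw [map_mul, map_mul, ← hs, Matrix.mul_apply, Matrix.mul_apply, Finset.sum_eq_single i₂,
    Finset.sum_eq_single i₃, m.tri 0 i₃ (one_lt_idxDist_iff.2 (by simp [h₃])), zero_mul] at hsb
  · have hs02 := (mul_eq_zero.1 hsb).resolve_right
      (m.irred _ _ (idxDist_eq_one_iff.2 (by omega)))
    have h00 := congrFun (congrFun (congrArg m.φ hSS) 0) 0
    rw [map_mul, map_one, ← hs, Matrix.mul_apply, Finset.sum_eq_zero, Matrix.one_apply_eq] at h00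
    · exact zero_ne_one h00
    · intro k _
      by_cases hk : s 0 k = 0
      · rw [hk, zero_mul]
      · obtain rfl : k = i₂ := m.θ_inj (by rw [h02, hs0 0 k hk, neg_neg])
        exact absurd hs02 hk
  · intro k _ hk
    by_contra hne
    exact hk (m.θ_inj (by rw [h13, hs0 k i₁ (right_ne_zero_of_mul hne)]))
  · simp
  · intro k _ hk
    by_contra hne
    exact hk (m.θ_inj (by rw [h02, hs0 0 k (left_ne_zero_of_mul hne), neg_neg]))
  · simp

/-- With `γ = 0`, consecutive eigenvalues satisfy `θᵢ₋₁ + θᵢ₊₁ = β θᵢ`. If `β = 0` this is the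
situation excluded by `bipartite_ne`; if `β = -1` it gives `θ₀ = θ₃`. -/
lemma Model.beta_ne (m : Model K A E As Es) (hd : 3 ≤ d) (hb : ∀ i, m.ψ A i i = 0) {β ϱ : K}
    (hP : ∀ i j, idxDist i j = 1 → awPoly β 0 ϱ (m.θ i) (m.θ j) = 0) : β ≠ 0 ∧ β + 1 ≠ 0 := by
  obtain ⟨i₁, h₁⟩ : ∃ i : Fin (d + 1), (i : ℕ) = 1 := ⟨⟨1, by omega⟩, rfl⟩
  obtain ⟨i₂, h₂⟩ : ∃ i : Fin (d + 1), (i : ℕ) = 2 := ⟨⟨2, by omega⟩, rfl⟩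
  obtain ⟨i₃, h₃⟩ : ∃ i : Fin (d + 1), (i : ℕ) = 3 := ⟨⟨3, by omega⟩, rfl⟩
  have d01 : idxDist 0 i₁ = 1 := idxDist_eq_one_iff.2 (by simp [h₁])
  have d12 : idxDist i₁ i₂ = 1 := idxDist_eq_one_iff.2 (by omega)
  have d23 : idxDist i₂ i₃ = 1 := idxDist_eq_one_iff.2 (by omega)
  have n02 : 0 ≠ i₂ := by rintro rfl; simp at h₂
  have n13 : i₁ ≠ i₃ := by rintro rfl; omega
  have n03 : 0 ≠ i₃ := by rintro rfl; simp at h₃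
  have g1 := awPoly_consecutive (hP _ _ d01) (hP _ _ d12) (m.θ_inj.ne n02)
  have g2 := awPoly_consecutive (hP _ _ d12) (hP _ _ d23) (m.θ_inj.ne n13)
  refine ⟨fun h => m.bipartite_ne hb h₁ h₂ h₃ ?_ ?_, fun h => n03 (m.θ_inj ?_)⟩
  · linear_combination -g1 + m.θ i₁ * h
  · linear_combination -g2 + m.θ i₂ * h
  · linear_combination g2 - g1 + (m.θ i₁ - m.θ i₂) * h

end Bipartite

/-! ### The bitridiagonal space, and the kernel and image. -/

section Main

variable {K : Type*} [Field K] {𝒜 : Type*} [Ring 𝒜] [Algebra K 𝒜] {d : ℕ}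
  {A As : 𝒜} {E Es : Fin (d + 1) → 𝒜}

lemma Model.generators_mem (m : Model K A E As Es) :
    1 ∈ tridSpace K E Es ∧ A ∈ tridSpace K E Es ∧ As ∈ tridSpace K E Es ∧
      A * As ∈ tridSpace K E Es ∧ As * A ∈ tridSpace K E Es := by
  have hne : ∀ i j : Fin (d + 1), 1 < idxDist i j → i ≠ j := by
    rintro i j h rfl; simp [idxDist] at h
  simp only [m.mem_tridSpace, map_one, map_mul, m.φ_A, m.ψ_As]
  refine ⟨⟨?_, ?_⟩, ⟨?_, m.tri_star⟩, ⟨m.tri, ?_⟩, ⟨?_, ?_⟩, ⟨?_, ?_⟩⟩ <;> intro i j h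
  · exact Matrix.one_apply_ne (hne i j h)
  · exact Matrix.one_apply_ne (hne i j h)
  · exact Matrix.diagonal_apply_ne _ (hne i j h)
  · exact Matrix.diagonal_apply_ne _ (hne i j h)
  · rw [Matrix.diagonal_mul, m.tri i j h, mul_zero]
  · rw [Matrix.mul_diagonal, m.tri_star i j h, zero_mul]
  · rw [Matrix.mul_diagonal, m.tri i j h, zero_mul]
  · rw [Matrix.diagonal_mul, m.tri_star i j h, mul_zero]

/-- The first two columns of a tridiagonal matrix have five free entries. As `A` has zero diagonal,
`1` and `As` fit the two diagonal ones, and `A`, `A * As`, `As * A` fit the three others. -/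
lemma Model.exists_sub_columns_eq_zero (m : Model K A E As Es) (hd : 3 ≤ d)
    (hb : ∀ i, m.ψ A i i = 0) {X : 𝒜} (hX : IsTri (m.ψ X)) :
    ∃ a b c e f : K, ∀ i j : Fin (d + 1), (j : ℕ) ≤ 1 →
      m.ψ (X - (a • (1 : 𝒜) + b • A + c • As + e • (A * As) + f • (As * A))) i j = 0 := by
  obtain ⟨i₁, h₁⟩ : ∃ i : Fin (d + 1), (i : ℕ) = 1 := ⟨⟨1, by omega⟩, rfl⟩
  obtain ⟨i₂, h₂⟩ : ∃ i : Fin (d + 1), (i : ℕ) = 2 := ⟨⟨2, by omega⟩, rfl⟩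
  have n01 : (0 : Fin (d + 1)) ≠ i₁ := by rintro rfl; simp at h₁
  have n02 : (0 : Fin (d + 1)) ≠ i₂ := by rintro rfl; simp at h₂
  have n12 : i₁ ≠ i₂ := by rintro rfl; omega
  have t01 := sub_ne_zero.2 (m.θs_inj.ne n01)
  have t02 := sub_ne_zero.2 (m.θs_inj.ne n02)
  set N := m.ψ X with hN
  set M := m.ψ A with hM
  have m01 : M 0 i₁ ≠ 0 := m.irred_star _ _ (idxDist_eq_one_iff.2 (by simp [h₁]))
  have m10 : M i₁ 0 ≠ 0 := m.irred_star _ _ (idxDist_eq_one_iff.2 (by simp [h₁]))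
  have m21 : M i₂ i₁ ≠ 0 := m.irred_star _ _ (idxDist_eq_one_iff.2 (by omega))
  -- Relative to `M i j`, the last three generators contribute `b + e θsⱼ + f θsᵢ`. Solving for the
  -- three ratios gives `f`, then `g = e - f`, then `b`.
  obtain ⟨r01, hr01⟩ : ∃ r, N 0 i₁ = r * M 0 i₁ := ⟨_, (div_mul_cancel₀ _ m01).symm⟩
  obtain ⟨r10, hr10⟩ : ∃ r, N i₁ 0 = r * M i₁ 0 := ⟨_, (div_mul_cancel₀ _ m10).symm⟩
  obtain ⟨r21, hr21⟩ : ∃ r, N i₂ i₁ = r * M i₂ i₁ := ⟨_, (div_mul_cancel₀ _ m21).symm⟩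
  obtain ⟨c, hc⟩ : ∃ c, N 0 0 - N i₁ i₁ = c * (m.θs 0 - m.θs i₁) :=
    ⟨_, (div_mul_cancel₀ _ t01).symm⟩
  obtain ⟨f, hf⟩ : ∃ f, r01 - r21 = f * (m.θs 0 - m.θs i₂) := ⟨_, (div_mul_cancel₀ _ t02).symm⟩
  obtain ⟨g, hg⟩ : ∃ g, r10 - r01 = g * (m.θs 0 - m.θs i₁) := ⟨_, (div_mul_cancel₀ _ t01).symm⟩
  refine ⟨N 0 0 - c * m.θs 0, r10 - (f + g) * m.θs 0 - f * m.θs i₁, c, f + g, f,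
    fun i j hj => ?_⟩
  simp only [map_sub, map_add, map_smul, map_mul, map_one, m.ψ_As, ← hN, ← hM, Matrix.sub_apply,
    Matrix.add_apply, Matrix.smul_apply, Matrix.mul_diagonal, Matrix.diagonal_mul, smul_eq_mul]
  rcases idxDist_trichotomy i j with rfl | h | h
  · rw [hb, Matrix.one_apply_eq, Matrix.diagonal_apply_eq]
    rcases Nat.lt_or_ge (i : ℕ) 1 with h | h
    · obtain rfl : i = 0 := Fin.ext (by rw [Fin.val_zero]; omega)
      ring
    · obtain rfl : i = i₁ := Fin.ext (by omega)
      linear_combination -hc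
  · have hij : i ≠ j := by rintro rfl; simp [idxDist] at h
    rw [Matrix.one_apply_ne hij, Matrix.diagonal_apply_ne _ hij]
    rw [idxDist_eq_one_iff] at h
    rcases Nat.lt_or_ge (j : ℕ) 1 with hj0 | hj0
    · obtain rfl : j = 0 := Fin.ext (by rw [Fin.val_zero]; omega)
      obtain rfl : i = i₁ := Fin.ext (by rw [Fin.val_zero] at h; omega)
      linear_combination hr10
    · obtain rfl : j = i₁ := Fin.ext (by omega)
      rcases h with h | h
      · obtain rfl : i = i₂ := Fin.ext (by omega)
        linear_combination hr21 - M i j * hg - M i j * hf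
      · obtain rfl : i = 0 := Fin.ext (by rw [Fin.val_zero]; omega)
        linear_combination hr01 - M 0 j * hg
  · have hij : i ≠ j := by rintro rfl; simp [idxDist] at h
    have hMij : M i j = 0 := m.tri_star i j h
    rw [hX i j h, hMij, Matrix.one_apply_ne hij, Matrix.diagonal_apply_ne _ hij]
    ring

/-- The recurrence makes `Υ(X)` diagonal in the eigenbasis of `A`. -/
lemma Model.upsElem_commute (m : Model K A E As Es) {β γ ϱ : K}
    (hP : ∀ i j, idxDist i j = 1 → awPoly β γ ϱ (m.θ i) (m.θ j) = 0) {X : 𝒜}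
    (hX : IsTri (m.φ X)) : upsElem β γ ϱ A X * A = A * upsElem β γ ϱ A X := by
  apply m.φ.injective
  rw [map_mul, map_mul, map_upsElem, m.φ_A]
  ext i j
  rw [Matrix.mul_diagonal, Matrix.diagonal_mul, upsElem_diagonal_apply]
  rcases idxDist_trichotomy i j with rfl | h | h
  · ring
  · rw [hP i j h]; ring
  · rw [hX i j h]; ring

/-- In the bipartite case the space of bitridiagonal elements is spanned by
`1, A, As, A * As, As * A`. -/
lemma Model.exists_eq_of_mem_tridSpace (m : Model K A E As Es) (hd : 3 ≤ d)
    (hb : ∀ i, m.ψ A i i = 0) {β ϱ : K}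
    (hP : ∀ i j, idxDist i j = 1 → awPoly β 0 ϱ (m.θ i) (m.θ j) = 0) {X : 𝒜}
    (hX : X ∈ tridSpace K E Es) : ∃ a b c e f : K,
      X = a • (1 : 𝒜) + b • A + c • As + e • (A * As) + f • (As * A) := by
  obtain ⟨g1, gA, gAs, gAAs, gAsA⟩ := m.generators_mem
  obtain ⟨a, b, c, e, f, h⟩ := m.exists_sub_columns_eq_zero hd hb ((m.mem_tridSpace X).1 hX).2
  refine ⟨a, b, c, e, f, ?_⟩
  rw [← sub_eq_zero]
  set Y := X - (a • (1 : 𝒜) + b • A + c • As + e • (A * As) + f • (As * A)) with hY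
  have hYmem : Y ∈ tridSpace K E Es :=
    sub_mem hX (add_mem (add_mem (add_mem (add_mem (Submodule.smul_mem _ _ g1)
      (Submodule.smul_mem _ _ gA)) (Submodule.smul_mem _ _ gAs)) (Submodule.smul_mem _ _ gAAs))
      (Submodule.smul_mem _ _ gAsA))
  rw [m.mem_tridSpace] at hYmem
  obtain ⟨hβ, hβ'⟩ := m.beta_ne hd hb hP
  have hQ := congrArg m.ψ (m.upsElem_commute hP hYmem.1)
  rw [map_mul, map_mul, map_upsElem] at hQ
  rw [← map_eq_zero_iff m.ψ m.ψ.injective]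
  exact eq_zero_of_commute_upsElem hd hβ hβ' m.tri_star m.irred_star hb hYmem.2
    (fun i => h i 0 (by simp)) (fun i j hj => h i j (by omega)) hQ

/-- `(a + b As) B = 0` forces `a = b = 0`, where `B = (2 - β) As² - 2 γs As - ϱs`. -/
lemma Model.elemB_independent (m : Model K A E As Es) (hd : 3 ≤ d) {β γs ϱs : K}
    (hPs : ∀ i j, idxDist i j = 1 → awPoly β γs ϱs (m.θs i) (m.θs j) = 0) {a b : K}
    (h : a • elemB As β γs ϱs + b • (As * elemB As β γs ϱs) = 0) : a = 0 ∧ b = 0 := by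
  obtain ⟨i₁, h₁⟩ : ∃ i : Fin (d + 1), (i : ℕ) = 1 := ⟨⟨1, by omega⟩, rfl⟩
  obtain ⟨i₂, h₂⟩ : ∃ i : Fin (d + 1), (i : ℕ) = 2 := ⟨⟨2, by omega⟩, rfl⟩
  obtain ⟨i₃, h₃⟩ : ∃ i : Fin (d + 1), (i : ℕ) = 3 := ⟨⟨3, by omega⟩, rfl⟩
  have key : ∀ i, (a + b * m.θs i) * awPoly β γs ϱs (m.θs i) (m.θs i) = 0 := by
    intro i
    have h' := congrFun (congrFun (congrArg m.ψ h) i) i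
    simp only [elemB, map_add, map_sub, map_smul, map_mul, map_pow, map_one, m.ψ_As,
      Matrix.add_apply, Matrix.sub_apply, Matrix.smul_apply, Matrix.diagonal_mul,
      Matrix.diagonal_pow, Matrix.diagonal_apply_eq, Matrix.one_apply_eq, smul_eq_mul,
      map_zero, Matrix.zero_apply, Pi.pow_apply] at h'
    rw [awPoly]
    linear_combination h'
  have n02 : (0 : Fin (d + 1)) ≠ i₂ := by rintro rfl; simp at h₂
  have hne : ∀ {i j}, i ≠ j → m.θs i - m.θs j ≠ 0 := fun h => sub_ne_zero.2 (m.θs_inj.ne h)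
  -- A quadratic with three roots vanishes identically: `2 - β = 2γ* = ϱ* = 0`. The recurrence then
  -- says adjacent eigenvalues differ by `γ*`, in either order, so `θs₀ = θs₂`. Keeping `2γ*` rather
  -- than `γ*` covers characteristic 2.
  have three : ∀ i j k, i ≠ j → j ≠ k → i ≠ k → awPoly β γs ϱs (m.θs i) (m.θs i) = 0 →
      awPoly β γs ϱs (m.θs j) (m.θs j) = 0 → awPoly β γs ϱs (m.θs k) (m.θs k) = 0 → False := by
    intro i j k hij hjk hik hi hj hk
    rw [awPoly] at hi hj hk
    have a1 : (2 - β) * (m.θs i + m.θs j) - 2 * γs = 0 := by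
      apply mul_left_cancel₀ (hne hij); linear_combination hi - hj
    have a2 : (2 - β) * (m.θs j + m.θs k) - 2 * γs = 0 := by
      apply mul_left_cancel₀ (hne hjk); linear_combination hj - hk
    have hβ : 2 - β = 0 := by
      apply mul_left_cancel₀ (hne hik); linear_combination a1 - a2
    have hγ : 2 * γs = 0 := by linear_combination (m.θs i + m.θs j) * hβ - a1
    have hϱ : ϱs = 0 := by linear_combination m.θs i ^ 2 * hβ - m.θs i * hγ - hi
    have step : ∀ i j, idxDist i j = 1 → m.θs i - m.θs j = γs := by
      intro i j h
      have hij : i ≠ j := by rintro rfl; simp [idxDist] at h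
      have := hPs i j h
      rw [awPoly] at this
      apply mul_left_cancel₀ (hne hij)
      linear_combination this - m.θs i * m.θs j * hβ + m.θs j * hγ + hϱ
    have s1 := step i₁ 0 (idxDist_eq_one_iff.2 (by simp [h₁]))
    have s2 := step i₁ i₂ (idxDist_eq_one_iff.2 (by omega))
    exact n02 (m.θs_inj (by linear_combination s2 - s1))
  by_contra hab
  -- A nonzero `a + b x` has at most one root among the eigenvalues, so `B*` must vanish at all the
  -- others; among four indices this yields three zeros.
  have two : ∀ i j, i ≠ j → awPoly β γs ϱs (m.θs i) (m.θs i) = 0 ∨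
      awPoly β γs ϱs (m.θs j) (m.θs j) = 0 := by
    intro i j hij
    by_contra! hq
    have ki := (mul_eq_zero.1 (key i)).resolve_right hq.1
    have kj := (mul_eq_zero.1 (key j)).resolve_right hq.2
    have hb : b = 0 := by
      apply mul_left_cancel₀ (hne hij); linear_combination ki - kj
    exact hab ⟨by linear_combination ki - m.θs i * hb, hb⟩
  have n03 : (0 : Fin (d + 1)) ≠ i₃ := by rintro rfl; simp at h₃
  have n01 : (0 : Fin (d + 1)) ≠ i₁ := by rintro rfl; simp at h₁
  have n12 : i₁ ≠ i₂ := by rintro rfl; omega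
  have n13 : i₁ ≠ i₃ := by rintro rfl; omega
  have n23 : i₂ ≠ i₃ := by rintro rfl; omega
  have t012 := three 0 i₁ i₂ n01 n12 n02
  have t013 := three 0 i₁ i₃ n01 n13 n03
  have t023 := three 0 i₂ i₃ n02 n23 n03
  have t123 := three i₁ i₂ i₃ n12 n23 n13
  rcases two 0 i₁ n01 with q0 | q1
  · rcases two i₁ i₂ n12 with q1 | q2
    · rcases two i₂ i₃ n23 with q2 | q3
      · exact t012 q0 q1 q2
      · exact t013 q0 q1 q3
    · rcases two i₁ i₃ n13 with q1 | q3
      · exact t012 q0 q1 q2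
      · exact t023 q0 q2 q3
  · rcases two 0 i₂ n02 with q0 | q2
    · rcases two i₂ i₃ n23 with q2 | q3
      · exact t012 q0 q1 q2
      · exact t013 q0 q1 q3
    · rcases two 0 i₃ n03 with q0 | q3
      · exact t012 q0 q1 q2
      · exact t123 q1 q2 q3

lemma upsElem_one (β γ ϱ : K) (a : 𝒜) : upsElem β γ ϱ a 1 = elemB a β γ ϱ := by
  simp only [upsElem, elemB, mul_one, one_mul, ← pow_two]
  module

lemma upsElem_self (β γ ϱ : K) (a : 𝒜) : upsElem β γ ϱ a a = a * elemB a β γ ϱ := by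
  simp only [upsElem, elemB, mul_one, mul_sub, mul_smul_comm, pow_two, mul_assoc]
  module

lemma upsElem_mul_self (β γ ϱ : K) (a X : 𝒜) :
    upsElem β γ ϱ a (X * a) = upsElem β γ ϱ a X * a := by
  simp only [upsElem, sub_mul, add_mul, smul_mul_assoc, pow_two, mul_assoc]

lemma upsElem_self_mul (β γ ϱ : K) (a X : 𝒜) :
    upsElem β γ ϱ a (a * X) = a * upsElem β γ ϱ a X := by
  simp only [upsElem, mul_sub, mul_add, mul_smul_comm, pow_two, mul_assoc]

lemma upsElem_comb {β γs ϱs : K} (hA : upsElem β γs ϱs As A = 0) (a b c e f : K) :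
    upsElem β γs ϱs As (a • (1 : 𝒜) + b • A + c • As + e • (A * As) + f • (As * A)) =
      a • elemB As β γs ϱs + c • (As * elemB As β γs ϱs) := by
  have lin : ∀ (r t : K) (X Y : 𝒜), upsElem β γs ϱs As (r • X + t • Y) =
      r • upsElem β γs ϱs As X + t • upsElem β γs ϱs As Y := by
    intro r t X Y
    simp only [upsElem, mul_add, add_mul, mul_smul_comm, smul_mul_assoc]
    module
  have lin1 : ∀ (t : K) (X Y : 𝒜), upsElem β γs ϱs As (X + t • Y) =
      upsElem β γs ϱs As X + t • upsElem β γs ϱs As Y := by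
    intro t X Y
    simpa using lin 1 t X Y
  rw [lin1, lin1, lin1, lin, upsElem_one, upsElem_self, upsElem_mul_self, upsElem_self_mul, hA]
  simp

lemma mem_kerIn_upsilon {𝒳 : Submodule K 𝒜} {a X : 𝒜} {β γ ϱ : K} :
    X ∈ kerIn (upsilon 𝒳 a β γ ϱ) ↔ X ∈ 𝒳 ∧ upsElem β γ ϱ a X = 0 := by
  rw [kerIn, Submodule.mem_map]
  constructor
  · rintro ⟨Y, hY, rfl⟩
    exact ⟨Y.2, hY⟩
  · rintro ⟨hX, h⟩
    exact ⟨⟨X, hX⟩, h, rfl⟩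

lemma mem_range_upsilon {𝒳 : Submodule K 𝒜} {a Y : 𝒜} {β γ ϱ : K} :
    Y ∈ LinearMap.range (upsilon 𝒳 a β γ ϱ) ↔ ∃ X ∈ 𝒳, upsElem β γ ϱ a X = Y := by
  rw [LinearMap.mem_range]
  constructor
  · rintro ⟨X, hX⟩
    exact ⟨X, X.2, hX⟩
  · rintro ⟨X, hX, h⟩
    exact ⟨⟨X, hX⟩, h⟩

/-- Comparing entries `(0, 1)` and `(2, 1)` would force `θs₀ = θs₂`. -/
lemma Model.not_mem_span_commutator (m : Model K A E As Es) (hd : 2 ≤ d) :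
    A ∉ Submodule.span K {A * As - As * A} := by
  intro h
  obtain ⟨c, hc⟩ := Submodule.mem_span_singleton.1 h
  have key : ∀ i j, idxDist i j = 1 → c * (m.θs j - m.θs i) = 1 := by
    intro i j hij
    have h' := congrFun (congrFun (congrArg m.ψ hc) i) j
    simp only [map_smul, map_sub, map_mul, m.ψ_As, Matrix.smul_apply, Matrix.sub_apply,
      Matrix.mul_diagonal, Matrix.diagonal_mul, smul_eq_mul] at h'
    apply mul_right_cancel₀ (m.irred_star i j hij)
    linear_combination h'
  have k1 := key 0 ⟨1, by omega⟩ (by simp [idxDist])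
  have k2 := key ⟨2, by omega⟩ ⟨1, by omega⟩ (by simp [idxDist])
  have hc0 : c ≠ 0 := left_ne_zero_of_mul (k1.trans_ne one_ne_zero)
  have := m.θs_inj (sub_right_injective (mul_left_cancel₀ hc0 (k1.trans k2.symm)))
  simp [Fin.ext_iff] at this

lemma Model.not_span_le (m : Model K A E As Es) (hd : 3 ≤ d) (B : 𝒜)
    (hB : ∃ q : Fin (d + 1) → K, m.ψ B = Matrix.diagonal q) :
    ¬ Submodule.span K {1, As, As ^ 2, As ^ 3} ≤ Submodule.span K {B, As * B} := by
  intro h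
  obtain ⟨q, hq⟩ := hB
  obtain ⟨a, b, h1⟩ := Submodule.mem_span_pair.1
    (h (Submodule.subset_span (by simp : (1 : 𝒜) ∈ ({1, As, As ^ 2, As ^ 3} : Set 𝒜))))
  obtain ⟨a', b', h2⟩ := Submodule.mem_span_pair.1
    (h (Submodule.subset_span (by simp : As ^ 2 ∈ ({1, As, As ^ 2, As ^ 3} : Set 𝒜))))
  have e1 : ∀ i, (a + b * m.θs i) * q i = 1 := by
    intro i
    have h' := congrFun (congrFun (congrArg m.ψ h1) i) i
    simp only [map_add, map_smul, map_mul, map_one, m.ψ_As, hq, Matrix.add_apply,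
      Matrix.smul_apply, Matrix.diagonal_mul, Matrix.diagonal_apply_eq, Matrix.one_apply_eq,
      smul_eq_mul] at h'
    linear_combination h'
  have e2 : ∀ i, (a' + b' * m.θs i) * q i = m.θs i ^ 2 := by
    intro i
    have h' := congrFun (congrFun (congrArg m.ψ h2) i) i
    simp only [map_add, map_smul, map_mul, map_pow, m.ψ_As, hq, Matrix.add_apply,
      Matrix.smul_apply, Matrix.diagonal_mul, Matrix.diagonal_apply_eq, Matrix.diagonal_pow,
      Pi.pow_apply, smul_eq_mul] at h'
    linear_combination h'
  -- Eliminating the nonzero `q i` from the expressions for `1` and `As ^ 2` leaves a polynomial of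
  -- degree at most 3 with `d + 1 ≥ 4` roots.
  let p : Polynomial K := .C b * .X ^ 3 + .C a * .X ^ 2 - .C b' * .X - .C a'
  have hp : p = 0 := by
    refine Polynomial.eq_zero_of_natDegree_lt_card_of_eval_eq_zero p m.θs_inj (fun i => ?_) ?_
    · simp only [p, Polynomial.eval_sub, Polynomial.eval_add, Polynomial.eval_mul,
        Polynomial.eval_C, Polynomial.eval_pow, Polynomial.eval_X]
      apply mul_right_cancel₀ (right_ne_zero_of_mul ((e1 i).trans_ne one_ne_zero))
      linear_combination m.θs i ^ 2 * e1 i - e2 i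
    · have : p.natDegree ≤ 3 := by
        simp only [p]; compute_degree
      rw [Fintype.card_fin]; omega
  have hb : b = 0 := by
    simpa [p, Polynomial.coeff_X, Polynomial.coeff_C, Polynomial.coeff_X_pow] using
      congrArg (fun r => Polynomial.coeff r 3) hp
  have ha : a = 0 := by
    simpa [p, Polynomial.coeff_X, Polynomial.coeff_C, Polynomial.coeff_X_pow] using
      congrArg (fun r => Polynomial.coeff r 2) hp
  have := e1 0
  simp [ha, hb] at this

lemma elemB_mem_span (a : 𝒜) (β γ ϱ : K) :
    Submodule.span K {elemB a β γ ϱ, a * elemB a β γ ϱ} ≤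
      Submodule.span K {1, a, a ^ 2, a ^ 3} := by
  have h0 : (1 : 𝒜) ∈ Submodule.span K {1, a, a ^ 2, a ^ 3} := Submodule.subset_span (by simp)
  have h1 : a ∈ Submodule.span K {1, a, a ^ 2, a ^ 3} := Submodule.subset_span (by simp)
  have h2 : a ^ 2 ∈ Submodule.span K {1, a, a ^ 2, a ^ 3} := Submodule.subset_span (by simp)
  have h3 : a ^ 3 ∈ Submodule.span K {1, a, a ^ 2, a ^ 3} := Submodule.subset_span (by simp)
  rw [Submodule.span_le]
  rintro x (rfl | rfl)
  · exact sub_mem (sub_mem (Submodule.smul_mem _ _ h2) (Submodule.smul_mem _ _ h1))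
      (Submodule.smul_mem _ _ h0)
  · have : a * elemB a β γ ϱ = (2 - β) • a ^ 3 - (2 * γ) • a ^ 2 - ϱ • a := by
      simp only [elemB, mul_sub, mul_smul_comm, mul_one, ← pow_succ', ← pow_two]
    rw [SetLike.mem_coe, this]
    exact sub_mem (sub_mem (Submodule.smul_mem _ _ h3) (Submodule.smul_mem _ _ h2))
      (Submodule.smul_mem _ _ h1)

lemma Model.bipartite_main (m : Model K A E As Es) (hd : 3 ≤ d) (hb : IsBipartite A Es)
    {s : AWScalars K} (hs : AskeyWilson A As s) :
    kerIn (upsilon (tridSpace K E Es) As s.β s.γs s.ϱs) = Submodule.span K {A, A * As, As * A} ∧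
    LinearMap.range (upsilon (tridSpace K E Es) As s.β s.γs s.ϱs) = Submodule.span K
      {elemB As s.β s.γs s.ϱs, As * elemB As s.β s.γs s.ϱs} ∧
    Submodule.span K {A * As - As * A} <
      kerIn (upsilon (tridSpace K E Es) As s.β s.γs s.ϱs) ∧
    LinearMap.range (upsilon (tridSpace K E Es) As s.β s.γs s.ϱs) <
      Submodule.span K {1, As, As ^ 2, As ^ 3} := by
  have hb' : ∀ i, m.ψ A i i = 0 := fun i =>
    (idempotent_sandwich_eq_zero_iff m.ψ m.ψ_Es A i i).1 (hb i)
  rw [askeyWilson_iff] at hs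
  have hP := m.awPoly_eq_zero hs.1
  have hPs := m.swap.awPoly_eq_zero hs.2
  obtain ⟨hγ, hω, hη⟩ := m.bipartite_coeffs (by omega) hb' hs.2
  have hA : upsElem s.β s.γs s.ϱs As A = 0 := by rw [hs.2, hγ, hω, hη]; simp
  rw [hγ] at hP
  obtain ⟨g1, gA, gAs, gAAs, gAsA⟩ := m.generators_mem
  have hker : kerIn (upsilon (tridSpace K E Es) As s.β s.γs s.ϱs) =
      Submodule.span K {A, A * As, As * A} := by
    apply le_antisymm
    · intro X hX
      obtain ⟨hX, hX0⟩ := mem_kerIn_upsilon.1 hX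
      obtain ⟨a, b, c, e, f, rfl⟩ := m.exists_eq_of_mem_tridSpace hd hb' hP hX
      rw [upsElem_comb hA] at hX0
      obtain ⟨rfl, rfl⟩ := m.elemB_independent hd hPs hX0
      exact Submodule.mem_span_triple.2 ⟨b, e, f, by simp⟩
    · rw [Submodule.span_le]
      rintro X (rfl | rfl | rfl) <;> rw [SetLike.mem_coe, mem_kerIn_upsilon]
      · exact ⟨gA, hA⟩
      · exact ⟨gAAs, by rw [upsElem_mul_self, hA, zero_mul]⟩
      · exact ⟨gAsA, by rw [upsElem_self_mul, hA, mul_zero]⟩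
  have hrange : LinearMap.range (upsilon (tridSpace K E Es) As s.β s.γs s.ϱs) =
      Submodule.span K {elemB As s.β s.γs s.ϱs, As * elemB As s.β s.γs s.ϱs} := by
    apply le_antisymm
    · intro Y hY
      obtain ⟨X, hX, rfl⟩ := mem_range_upsilon.1 hY
      obtain ⟨a, b, c, e, f, rfl⟩ := m.exists_eq_of_mem_tridSpace hd hb' hP hX
      exact Submodule.mem_span_pair.2 ⟨a, c, (upsElem_comb hA a b c e f).symm⟩
    · rw [Submodule.span_le]
      rintro X (rfl | rfl) <;> rw [SetLike.mem_coe, mem_range_upsilon]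
      · exact ⟨1, g1, upsElem_one _ _ _ _⟩
      · exact ⟨As, gAs, upsElem_self _ _ _ _⟩
  refine ⟨hker, hrange, ?_, ?_⟩
  · rw [SetLike.lt_iff_le_and_exists, hker]
    refine ⟨?_, A, Submodule.subset_span (by simp), m.not_mem_span_commutator (by omega)⟩
    rw [Submodule.span_singleton_le_iff_mem]
    exact sub_mem (Submodule.subset_span (by simp)) (Submodule.subset_span (by simp))
  · rw [hrange]
    refine lt_of_le_not_ge (elemB_mem_span _ _ _ _) (m.not_span_le hd _
      ⟨fun i => (2 - s.β) * m.θs i ^ 2 - 2 * s.γs * m.θs i - s.ϱs, ?_⟩)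
    simp only [elemB, map_sub, map_smul, map_pow, map_one, m.ψ_As, Matrix.diagonal_pow]
    ext i j
    by_cases hij : i = j
    · subst hij; simp
    · simp [hij]

lemma tridSpace_swap : tridSpace K E Es = tridSpace K Es E := by
  ext X
  exact and_comm

/-- Interchange the roles of the two parameter families. -/
def AWScalars.swap (s : AWScalars K) : AWScalars K :=
  ⟨s.β, s.γs, s.γ, s.ϱs, s.ϱ, s.ω, s.ηs, s.η⟩

lemma AskeyWilson.swap {s : AWScalars K} (h : AskeyWilson A As s) : AskeyWilson As A s.swap :=
  ⟨h.2, h.1⟩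

end Main

end Leonard

theorem lemma6p8 {K : Type*} [Field K] {𝒜 : Type*} [Ring 𝒜] [Algebra K 𝒜]
    (d : ℕ) (hd : 3 ≤ d)
    (h𝒜 : Nonempty (𝒜 ≃ₐ[K] Matrix (Fin (d + 1)) (Fin (d + 1)) K))
    (A As : 𝒜) (E Es : Fin (d + 1) → 𝒜)
    (hΦ : Leonard.IsLeonardSystem K A E As Es) :
    (∃! s : Leonard.AWScalars K, Leonard.AskeyWilson A As s) ∧
    ∀ s : Leonard.AWScalars K, Leonard.AskeyWilson A As s →
      (Leonard.IsBipartite A Es →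
        Leonard.kerIn (Leonard.upsilon (Leonard.tridSpace K E Es) As s.β s.γs s.ϱs)
            = Submodule.span K {A, A * As, As * A} ∧
        LinearMap.range (Leonard.upsilon (Leonard.tridSpace K E Es) As s.β s.γs s.ϱs)
            = Submodule.span K
                {Leonard.elemB As s.β s.γs s.ϱs, As * Leonard.elemB As s.β s.γs s.ϱs} ∧
        Submodule.span K {A * As - As * A}
            < Leonard.kerIn (Leonard.upsilon (Leonard.tridSpace K E Es) As s.β s.γs s.ϱs) ∧
        LinearMap.range (Leonard.upsilon (Leonard.tridSpace K E Es) As s.β s.γs s.ϱs)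
            < Submodule.span K {1, As, As ^ 2, As ^ 3}) ∧
      (Leonard.IsDualBipartite As E →
        Leonard.kerIn (Leonard.upsilon (Leonard.tridSpace K E Es) A s.β s.γ s.ϱ)
            = Submodule.span K {As, As * A, A * As} ∧
        LinearMap.range (Leonard.upsilon (Leonard.tridSpace K E Es) A s.β s.γ s.ϱ)
            = Submodule.span K
                {Leonard.elemB A s.β s.γ s.ϱ, A * Leonard.elemB A s.β s.γ s.ϱ} ∧
        Submodule.span K {A * As - As * A}
            < Leonard.kerIn (Leonard.upsilon (Leonard.tridSpace K E Es) A s.β s.γ s.ϱ) ∧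
        LinearMap.range (Leonard.upsilon (Leonard.tridSpace K E Es) A s.β s.γ s.ϱ)
            < Submodule.span K {1, A, A ^ 2, A ^ 3}) := by
  obtain ⟨m⟩ := hΦ.nonempty_model h𝒜
  refine ⟨m.existsUnique_askeyWilson hd, fun s hs => ⟨fun hb => m.bipartite_main hd hb hs,
    fun hb => ?_⟩⟩
  -- The exchanged system has the same bitridiagonal space, and its commutator differs only in sign.
  obtain ⟨h1, h2, h3, h4⟩ := m.swap.bipartite_main hd hb hs.swap
  rw [← Leonard.tridSpace_swap] at h1 h2 h3 h4
  refine ⟨h1.trans ?_, h2, ?_, h4⟩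
  · rfl
  · rwa [← Submodule.span_neg, Set.neg_singleton, neg_sub]
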